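/- Let $\lambda,\lambda_b>0$, $\alpha>2$, $P_u\ge 0$. The active base stations (BSs) form a homogeneous Poisson point process $\Phi_b=\{x_i\}$ on $\mathbb R^2$ of intensity $\lambda_b$. Attached to each $x_i$ are marks: a transmit power $P_{x_i}\in[0,P_{\max}]$ (a common peak power $P_{\max}$), a link distance $R_{x_i}$ with density $f_R(r)=2\pi\lambda r e^{-\pi\lambda r^2}$, $r\ge 0$, an angle $\varphi_{x_i}$ uniform on $[0,2\pi)$, and two exponential fading coefficients $h_{x_i},h_{m(x_i)}$ of unit mean. The mark vectors of different BSs are i.i.d. and independent of $\Phi_b$; within a mark vector, the pair $(P_{x_i},R_{x_i})$, the angle and the two fading coefficients are independent. The user equipment (UE) served by $x_i$ is located at $m(x_i)=x_i+R_{x_i}(\cos\varphi_{x_i},\sin\varphi_{x_i})$ and transmits with power $P_u$. The aggregate interference at the UE $m(x_0)$ of a BS $x_0\in\Phi_b$ is $$I=\sum_{x_i\in\Phi_b\setminus\{x_0\}}\Big(P_{x_i}h_{x_i}\|x_i-m(x_0)\|^{-\alpha}+P_u h_{m(x_i)}\|m(x_i)-m(x_0)\|^{-\alpha}\Big).$$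 Let $\mathcal L_I(s)$ be the Laplace transform of $I$ at the typical UE, i.e. under the Palm distribution: for a Borel set $W\subset\mathbb R^2$ with $0<|W|<\infty$, $\mathcal L_I(s)=\frac{1}{\lambda_b|W|}\,\mathbb E\sum_{x_0\in\Phi_b\cap W}e^{-sI}$, where $I$ is the interference at $m(x_0)$. Then almost surely the interference is finite at every UE of the network, and for every such $W$ and every $s\ge 0$ the following hold. (i) If the transmit power of a BS is independent of its link distance, then $$\mathcal L_I(s)=\exp\bigg(-2\pi\lambda_b\,\mathbb E_P\bigg\{\int_0^\infty\bigg(1-\int_0^{2\pi}\!\!\int_0^\infty\frac{1}{1+sPv^{-\alpha}}\cdot\frac{\lambda r e^{-\pi\lambda r^2}\,dr\,d\varphi}{1+sP_u\,(v^2+r^2+2vr\cos\varphi)^{-\alpha/2}}\bigg)v\,dv\bigg\}\bigg).$$ (ii) In general, when the power of a BS may depend on its link distance, the same holds with the average over the link distance taken jointly with the power: $$\mathcal L_I(s)=\exp\bigg(-2\pi\lambda_b\,\mathbb E_{P,R}\bigg\{\int_0^\infty\bigg(1-\frac1{2\pi}\int_0^{2\pi}\frac{1}{1+sPv^{-\alpha}}\cdot\frac{d\varphi}{1+sP_u\,(v^2+R^2+2vR\cos\varphi)^{-\alpha/2}}\bigg)v\,dv\bigg\}\bigg).$$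 -/

import Mathlib

open MeasureTheory ProbabilityTheory

open scoped ENNReal

noncomputable section

namespace FDNetwork

/-- The Euclidean plane in which base stations (BSs) and user equipments (UEs) live. -/
abbrev Plane : Type := EuclideanSpace ℝ (Fin 2)

/-- Number of points of the (enumerated) point process `X` that fall in `B`. -/
def count {Ω : Type*} (X : ℕ → Ω → Plane) (B : Set Plane) (ω : Ω) : ℝ≥0∞ :=
  ∑' i, B.indicator (fun _ => (1 : ℝ≥0∞)) (X i ω)

/-- `X` enumerates the points of a homogeneous Poisson point process on the plane with intensity
`lamB`: the number of points in a Borel set of finite area is Poisson distributed with mean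
`lamB` times the area, and the numbers of points in disjoint sets are independent. (For
`lamB > 0` the process has almost surely infinitely many points, so that it can be
enumerated by `ℕ`.) -/
structure IsHomogeneousPPP {Ω : Type*} [MeasurableSpace Ω] (μ : Measure Ω) (lamB : ℝ)
    (X : ℕ → Ω → Plane) : Prop where
  measurable : ∀ i, Measurable (X i)
  hasLaw_count : ∀ B : Set Plane, MeasurableSet B → volume B ≠ ∞ →
    HasLaw (count X B)
      ((poissonMeasure (lamB * volume.real B).toNNReal).map (fun n : ℕ => (n : ℝ≥0∞))) μ
  indep_count : ∀ (n : ℕ) (B : Fin n → Set Plane), (∀ k, MeasurableSet (B k)) →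
    (∀ k, volume (B k) ≠ ∞) → Pairwise (fun k l => Disjoint (B k) (B l)) →
    iIndepFun (fun k => count X (B k)) μ

/-- The law of the link distance: density `2 π lam r exp (-lam π r ^ 2)` on `r ≥ 0`. -/
def linkDistanceMeasure (lam : ℝ) : Measure ℝ :=
  volume.withDensity (fun r =>
    ENNReal.ofReal (if 0 ≤ r then 2 * Real.pi * lam * r * Real.exp (-lam * Real.pi * r ^ 2) else 0))

/-- The uniform law of an angle. -/
def angleMeasure : Measure ℝ := ProbabilityTheory.cond volume (Set.Ico 0 (2 * Real.pi))

/-- The random quantities that make up the network: the `i`-th active BS is at `X i`, transmits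
with power `P i`, and its dedicated UE is at distance `R i` in direction `φ i`; `hB i` and
`hU i` are the fading coefficients of the interfering links from the `i`-th BS and from
its UE. -/
structure Network (Ω : Type*) where
  X : ℕ → Ω → Plane
  P : ℕ → Ω → ℝ
  R : ℕ → Ω → ℝ
  φ : ℕ → Ω → ℝ
  hB : ℕ → Ω → ℝ
  hU : ℕ → Ω → ℝ

namespace Network

variable {Ω : Type*}

/-- The mark of the `i`-th BS: power and link distance, direction, the two fading coefficients. -/
def mark (N : Network Ω) (i : ℕ) (ω : Ω) : (ℝ × ℝ) × ℝ × ℝ × ℝ :=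
  ((N.P i ω, N.R i ω), N.φ i ω, N.hB i ω, N.hU i ω)

/-- The location `m(x_i)` of the UE that is served by the `i`-th BS. -/
def ue (N : Network Ω) (i : ℕ) (ω : Ω) : Plane :=
  N.X i ω + !₂[N.R i ω * Real.cos (N.φ i ω), N.R i ω * Real.sin (N.φ i ω)]

/-- The contribution of the `j`-th BS-UE pair to the interference received at `y`, for path loss
exponent `α` and UE transmit power `Pu`. -/
def pairInterference (N : Network Ω) (α Pu : ℝ) (j : ℕ) (y : Plane) (ω : Ω) : ℝ :=
  N.P j ω * N.hB j ω * ‖N.X j ω - y‖ ^ (-α) + Pu * N.hU j ω * ‖N.ue j ω - y‖ ^ (-α)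

/-- The aggregate interference at the UE of the `i`-th BS, from all the other pairs. -/
def interference (N : Network Ω) (α Pu : ℝ) (i : ℕ) (ω : Ω) : ℝ :=
  ∑' j, if j = i then 0 else N.pairInterference α Pu j (N.ue i ω) ω

variable [MeasurableSpace Ω]

/-- The network is an independently marked Poisson point process: the active BSs form a
homogeneous Poisson point process of intensity `lamB`, and the marks are i.i.d. and independent
of the BS locations. Power and link distance have the joint law `ν`; independently of them
the direction is uniform and the fading coefficients are exponential with unit mean. -/
structure IsMarkedPPP (N : Network Ω) (μ : Measure Ω) (lamB : ℝ) (ν : Measure (ℝ × ℝ)) :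
    Prop where
  ppp : IsHomogeneousPPP μ lamB N.X
  measurable_mark : ∀ i, Measurable (N.mark i)
  hasLaw_mark : ∀ i,
    HasLaw (N.mark i) (ν.prod (angleMeasure.prod ((expMeasure 1).prod (expMeasure 1)))) μ
  iIndep_mark : iIndepFun N.mark μ
  indep_mark : IndepFun (fun ω i => N.X i ω) (fun ω i => N.mark i ω) μ

/-- The Laplace transform at `s` of the aggregate interference at the typical UE, i.e. its
expectation under the Palm distribution of the network: the mean of `exp (-s I)` over the UEs
whose BS lies in the window `W`, where the BSs have intensity `lamB`. -/
def typicalLaplace (N : Network Ω) (μ : Measure Ω) (lamB α Pu : ℝ) (W : Set Plane) (s : ℝ) : ℝ :=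
  (∫ ω, ∑' i, W.indicator (fun _ => Real.exp (-s * N.interference α Pu i ω)) (N.X i ω) ∂μ)
    / (lamB * volume.real W)

end Network

end FDNetwork

end

/-! The interference is a shot noise of the marked Poisson process. Its Palm Laplace transform is
computed in `[0, ∞]`, where sums and integrals need no integrability conditions. The Laplace
functional `E exp (-∑ f(x_i)) = exp (-λ_b ∫ (1 - e^{-f}))` comes from simple functions by monotone
approximation (`IsHomogeneousPPP.laplace`). Replacing `f` by `f + t 1_A` and differentiating at `t =
0` gives `E [N(A) exp (-∑ f(x_i))]`, a measure in `A`. Integrating `g e^f` against it removes the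
term of the distinguished point and yields the reduced Campbell formula
(`lintegral_tsum_mul_expNeg`).

The obstacle is that the observation point `m(x_0)` depends on `x_0` and its mark, whereas that
formula needs `f` to be free of the removed point. In `palm_laplace_marked` the marks of the other
points are averaged first; being i.i.d., they replace the contribution `g(z, b)` by `F(z) = -log E
e^{-g(z, b)}`. The displacement of the UE has a density `p`, so averaging over it is an integral
over the UE location `y`. For fixed `y` the removed point enters only through the weight `1_W(x) p(y
- x)`, and the reduced Campbell formula applies to `F(· - y)`. Translation invariance makes the
exponential factor the same for all `y`, and `∫∫ 1_W(x) p(y - x) = |W|`.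

Averaging over the exponential fading turns each link into a factor `1/(1 + t)`, and polar
coordinates about the UE give (ii); Fubini under independence then gives (i). Since `1 -
1/((1+a)(1+b)) ≤ min 1 a + min 1 b` and `α > 2`, the exponent is finite and tends to `0` with `s`.
Letting `s → 0` in the formula shows that the expected number of UEs with BS in `W` and infinite
interference is `0`, which permits the return to real-valued sums. -/

namespace FDNetwork

open Filter Topology

/-! ### Negative exponential on `[0, ∞]` and the Poisson law -/

/-- The function `x ↦ exp (-x)` on `[0, ∞]`. -/
noncomputable def expNeg (x : ℝ≥0∞) : ℝ≥0∞ := EReal.exp (-(x : EReal))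

lemma expNeg_zero : expNeg 0 = 1 := by simp [expNeg]

lemma expNeg_top : expNeg ∞ = 0 := by simp [expNeg]

lemma continuous_expNeg : Continuous expNeg :=
  ENNReal.continuous_exp.comp (continuous_neg.comp continuous_coe_ennreal_ereal)

@[fun_prop]
lemma measurable_expNeg : Measurable expNeg := continuous_expNeg.measurable

lemma antitone_expNeg : Antitone expNeg := fun _ _ h =>
  EReal.exp_monotone (EReal.neg_le_neg_iff.2 (by exact_mod_cast h))

lemma expNeg_le_one (x : ℝ≥0∞) : expNeg x ≤ 1 :=
  expNeg_zero ▸ antitone_expNeg (zero_le (a := x))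

lemma expNeg_ne_top (x : ℝ≥0∞) : expNeg x ≠ ∞ :=
  ((expNeg_le_one x).trans_lt ENNReal.one_lt_top).ne

lemma expNeg_add (x y : ℝ≥0∞) : expNeg (x + y) = expNeg x * expNeg y := by
  rw [expNeg, EReal.coe_ennreal_add, EReal.neg_add (by simp) (by simp), sub_eq_add_neg,
    EReal.exp_add]
  rfl

lemma expNeg_sum {ι : Type*} (s : Finset ι) (f : ι → ℝ≥0∞) :
    expNeg (∑ i ∈ s, f i) = ∏ i ∈ s, expNeg (f i) := by
  classical
  induction s using Finset.induction_on with
  | empty => simp [expNeg_zero]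
  | insert a s ha ih => rw [Finset.sum_insert ha, Finset.prod_insert ha, expNeg_add, ih]

lemma expNeg_ofReal {x : ℝ} (hx : 0 ≤ x) :
    expNeg (ENNReal.ofReal x) = ENNReal.ofReal (Real.exp (-x)) := by
  rw [expNeg, EReal.coe_ennreal_ofReal, max_eq_left hx, ← EReal.coe_neg, EReal.exp_coe]

lemma expNeg_of_ne_top {x : ℝ≥0∞} (hx : x ≠ ∞) :
    expNeg x = ENNReal.ofReal (Real.exp (-x.toReal)) := by
  rw [← expNeg_ofReal ENNReal.toReal_nonneg, ENNReal.ofReal_toReal hx]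

lemma expNeg_eq_zero_iff {x : ℝ≥0∞} : expNeg x = 0 ↔ x = ∞ := by
  rw [expNeg, EReal.exp_eq_zero_iff, EReal.neg_eq_bot_iff]; simp

lemma one_sub_expNeg_le (x : ℝ≥0∞) : 1 - expNeg x ≤ min 1 x := by
  refine le_min tsub_le_self ?_
  rcases eq_or_ne x ∞ with rfl | hx
  · exact le_top
  · rw [expNeg_of_ne_top hx, ← ENNReal.ofReal_one, ← ENNReal.ofReal_sub _ (Real.exp_pos _).le]
    refine ENNReal.ofReal_le_of_le_toReal ?_
    linarith [Real.add_one_le_exp (-x.toReal)]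

/-- The inverse of `expNeg` on `[0, 1]`. -/
noncomputable def negLog (x : ℝ≥0∞) : ℝ≥0∞ := (-(ENNReal.log x)).toENNReal

@[fun_prop]
lemma measurable_negLog : Measurable negLog :=
  (measurable_ereal_toENNReal.comp (continuous_neg.measurable.comp ENNReal.measurable_log))

lemma expNeg_negLog {x : ℝ≥0∞} (hx : x ≤ 1) : expNeg (negLog x) = x := by
  have h : (0 : EReal) ≤ -(ENNReal.log x) := by
    rw [EReal.le_neg]; simpa using hx
  rw [expNeg, negLog, EReal.coe_toENNReal h, neg_neg, ENNReal.exp_log]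

lemma negLog_ne_top {x : ℝ≥0∞} (hx : x ≤ 1) (h0 : x ≠ 0) : negLog x ≠ ∞ := fun h =>
  h0 (by rw [← expNeg_negLog hx, h, expNeg_top])

/-- The factor `e^{-cn}` turns the Poisson weights into the exponential series at `m e^{-c}`, with
sum `e^{-m} e^{m e^{-c}}`. -/
lemma lintegral_expNeg_poisson (m : NNReal) (c : ℝ≥0∞) (hc : c ≠ ∞) :
    ∫⁻ x, expNeg (c * x) ∂((poissonMeasure m).map (fun n : ℕ => (n : ℝ≥0∞)))
      = expNeg (m * (1 - expNeg c)) := by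
  rw [lintegral_map (by fun_prop) (by fun_prop), poissonMeasure, lintegral_sum_measure]
  simp only [lintegral_smul_measure, lintegral_dirac, smul_eq_mul]
  lift c to NNReal using hc
  have h1 : ∀ n : ℕ, ENNReal.ofReal (Real.exp (-m) * m ^ n / n.factorial) * expNeg (c * n)
      = ENNReal.ofReal (Real.exp (-m) * ((m * Real.exp (-c)) ^ n / n.factorial)) := by
    intro n
    rw [expNeg_of_ne_top (ENNReal.mul_ne_top (by simp) (by simp)),
      ← ENNReal.ofReal_mul (by positivity)]
    congr 1
    rw [mul_pow, ← Real.exp_nat_mul]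
    simp only [ENNReal.toReal_mul, ENNReal.coe_toReal, ENNReal.toReal_natCast]
    rw [show -((c : ℝ) * n) = n * (-(c : ℝ)) by ring]
    ring
  simp_rw [h1]
  have h2 : HasSum (fun n : ℕ => Real.exp (-m) * ((m * Real.exp (-c)) ^ n / n.factorial))
      (Real.exp (-m) * Real.exp (m * Real.exp (-c))) := by
    have := (NormedSpace.expSeries_div_hasSum_exp ((m : ℝ) * Real.exp (-c)))
    rw [← Real.exp_eq_exp_ℝ] at this
    exact this.mul_left _
  rw [← ENNReal.ofReal_tsum_of_nonneg (fun n => by positivity) h2.summable, h2.tsum_eq,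
    ← Real.exp_add, expNeg_of_ne_top]
  · congr 2
    rw [expNeg_of_ne_top (by simp), ENNReal.toReal_mul, ENNReal.toReal_sub_of_le]
    · simp only [ENNReal.coe_toReal, ENNReal.toReal_one]
      rw [ENNReal.toReal_ofReal (by positivity)]
      ring
    · rw [← ENNReal.ofReal_one]
      exact ENNReal.ofReal_le_ofReal (Real.exp_le_one_iff.2 (by simp))
    · simp
  · exact ENNReal.mul_ne_top (by simp) (by simp)

/-- The term `n = 0` vanishes, and cancelling `n + 1` against the factorial leaves `m` times the
total mass. -/
lemma lintegral_id_poisson (m : NNReal) :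
    ∫⁻ x, x ∂((poissonMeasure m).map (fun n : ℕ => (n : ℝ≥0∞))) = m := by
  rw [lintegral_map (by fun_prop) (by fun_prop), poissonMeasure, lintegral_sum_measure]
  simp only [lintegral_smul_measure, lintegral_dirac, smul_eq_mul]
  rw [tsum_eq_zero_add' ENNReal.summable]
  have h1 : ∀ n : ℕ, ENNReal.ofReal (Real.exp (-m) * m ^ (n + 1) / (n + 1).factorial)
        * ((n + 1 : ℕ) : ℝ≥0∞)
      = m * ENNReal.ofReal (Real.exp (-m) * m ^ n / n.factorial) := by
    intro n
    rw [← ENNReal.ofReal_natCast, ← ENNReal.ofReal_coe_nnreal (p := m),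
      ← ENNReal.ofReal_mul (by positivity), ← ENNReal.ofReal_mul (by positivity)]
    congr 1
    rw [Nat.factorial_succ]
    have : ((n : ℝ) + 1) ≠ 0 := by positivity
    have : (n.factorial : ℝ) ≠ 0 := by positivity
    push_cast
    field_simp
    ring
  simp_rw [h1]
  rw [ENNReal.tsum_mul_left,
    ← ENNReal.ofReal_tsum_of_nonneg (fun n => by positivity) (hasSum_one_poissonMeasure m).summable,
    (hasSum_one_poissonMeasure m).tsum_eq]
  simp

/-! ### Laplace functional of the Poisson process -/

variable {Ω : Type*} [MeasurableSpace Ω] {μ : Measure Ω} {lamB : ℝ} {X : ℕ → Ω → Plane}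

lemma measurable_count (hX : ∀ i, Measurable (X i)) {B : Set Plane} (hB : MeasurableSet B) :
    Measurable (count X B) :=
  Measurable.tsum fun i => (measurable_const.indicator hB).comp (hX i)

lemma coe_mean_eq (hl : 0 ≤ lamB) {B : Set Plane} (hB : volume B ≠ ∞) :
    (((lamB * volume.real B).toNNReal : NNReal) : ℝ≥0∞) = ENNReal.ofReal lamB * volume B := by
  rw [← ENNReal.ofReal, ENNReal.ofReal_mul hl, measureReal_def, ENNReal.ofReal_toReal hB]

namespace IsHomogeneousPPP

lemma lintegral_count (h : IsHomogeneousPPP μ lamB X) (hl : 0 ≤ lamB) {B : Set Plane}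
    (hB : MeasurableSet B) (hB' : volume B ≠ ∞) :
    ∫⁻ ω, count X B ω ∂μ = ENNReal.ofReal lamB * volume B := by
  rw [← coe_mean_eq hl hB', ← lintegral_id_poisson, ← (h.hasLaw_count B hB hB').map_eq,
    lintegral_map (by fun_prop) (measurable_count h.measurable hB)]

lemma lintegral_expNeg_count (h : IsHomogeneousPPP μ lamB X) (hl : 0 ≤ lamB) {B : Set Plane}
    (hB : MeasurableSet B) (hB' : volume B ≠ ∞) {c : ℝ≥0∞} (hc : c ≠ ∞) :
    ∫⁻ ω, expNeg (c * count X B ω) ∂μ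
      = expNeg (ENNReal.ofReal lamB * volume B * (1 - expNeg c)) := by
  rw [← coe_mean_eq hl hB', ← lintegral_expNeg_poisson _ c hc, ← (h.hasLaw_count B hB hB').map_eq,
    lintegral_map (by fun_prop) (measurable_count h.measurable hB)]

/-- The sum over the points is `∑ c N(f = c)`. The level sets are disjoint, so the counts are
independent Poisson variables and the expectation factorises. -/
lemma laplace_simpleFunc (h : IsHomogeneousPPP μ lamB X) (hl : 0 ≤ lamB)
    (f : SimpleFunc Plane ℝ≥0∞) (hf : ∀ x, f x ≠ ∞)
    (hf' : ∀ c, c ≠ 0 → volume (f ⁻¹' {c}) ≠ ∞) :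
    ∫⁻ ω, expNeg (∑' i, f (X i ω)) ∂μ
      = expNeg (ENNReal.ofReal lamB * ∫⁻ x, (1 - expNeg (f x))) := by
  classical
  -- The value `0` is left out: its level set may have infinite area, and it contributes nothing to
  -- either side.
  set s : Finset ℝ≥0∞ := f.range.filter (· ≠ 0) with hs
  have hmem : ∀ c ∈ s, c ≠ 0 ∧ c ≠ ∞ := by
    intro c hc
    simp only [hs, Finset.mem_filter, SimpleFunc.mem_range, Set.mem_range] at hc
    obtain ⟨⟨x, rfl⟩, h0⟩ := hc
    exact ⟨h0, hf x⟩
  have hsum : ∀ ω, ∑' i, f (X i ω) = ∑ c ∈ s, c * count X (f ⁻¹' {c}) ω := by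
    intro ω
    have hpt : ∀ x, f x = ∑ c ∈ s, c * (f ⁻¹' {c}).indicator (fun _ => (1 : ℝ≥0∞)) x := by
      intro x
      by_cases h0 : f x = 0
      · rw [h0, Finset.sum_eq_zero]
        intro c hc
        rw [Set.indicator_of_notMem, mul_zero]
        simp only [Set.mem_preimage, Set.mem_singleton_iff, h0]
        exact (hmem c hc).1.symm
      · rw [Finset.sum_eq_single (f x)]
        · simp
        · intro c _ hc
          rw [Set.indicator_of_notMem, mul_zero]
          simpa using hc.symm
        · intro hx
          exact absurd (by simp [hs, h0]) hx
    simp_rw [fun i => hpt (X i ω), count]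
    rw [Summable.tsum_finsetSum (fun _ _ => ENNReal.summable)]
    simp_rw [ENNReal.tsum_mul_left]
  set e : Fin s.card ≃ s := s.equivFin.symm
  have hind := h.indep_count s.card (fun k => f ⁻¹' {(e k : ℝ≥0∞)})
    (fun k => f.measurableSet_fiber _) (fun k => hf' _ (hmem _ (e k).2).1) (by
      intro k l hkl
      refine Disjoint.preimage _ (Set.disjoint_singleton.2 fun hh => hkl ?_)
      exact e.injective (Subtype.ext hh))
  have hprod : ∀ F : ℝ≥0∞ → ℝ≥0∞, ∏ c ∈ s, F c = ∏ k, F (e k) := by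
    intro F
    rw [← Finset.prod_coe_sort]
    exact (e.prod_comp (fun c : s => F c)).symm
  simp_rw [hsum, expNeg_sum, hprod]
  have hcomp := hind.comp (fun k x => expNeg ((e k : ℝ≥0∞) * x)) (fun k => by fun_prop)
  rw [lintegral_prod_eq_prod_lintegral_of_indepFun Finset.univ
    (fun k ω => expNeg ((e k : ℝ≥0∞) * count X (f ⁻¹' {(e k : ℝ≥0∞)}) ω)) hcomp
    (fun k => by
      have := measurable_count h.measurable (f.measurableSet_fiber (e k : ℝ≥0∞))
      fun_prop)]
  simp_rw [fun k => h.lintegral_expNeg_count hl (f.measurableSet_fiber _)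
    (hf' _ (hmem _ (e k).2).1) (hmem _ (e k).2).2]
  rw [← hprod (fun c => expNeg (ENNReal.ofReal lamB * volume (f ⁻¹' {c}) * (1 - expNeg c))),
    ← expNeg_sum]
  congr 1
  have : ∫⁻ x, (1 - expNeg (f x)) = (f.map (fun c => 1 - expNeg c)).lintegral volume := by
    rw [← SimpleFunc.lintegral_eq_lintegral]
    rfl
  rw [this, SimpleFunc.map_lintegral, Finset.mul_sum, hs, Finset.sum_filter]
  refine Finset.sum_congr rfl fun c _ => ?_
  split_ifs with h0
  · ring
  · rw [not_not] at h0
    simp [h0, expNeg_zero]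

/-- Simple functions cut off to sets of finite area increase to `f`. The left side converges by
domination by `1`, the right side by monotone convergence. -/
lemma laplace (h : IsHomogeneousPPP μ lamB X) (hl : 0 ≤ lamB) [IsProbabilityMeasure μ]
    {f : Plane → ℝ≥0∞} (hf : Measurable f) :
    ∫⁻ ω, expNeg (∑' i, f (X i ω)) ∂μ
      = expNeg (ENNReal.ofReal lamB * ∫⁻ x, (1 - expNeg (f x))) := by
  set S := spanningSets (volume : Measure Plane)
  have hS : ∀ n, MeasurableSet (S n) := measurableSet_spanningSets _
  set g : ℕ → SimpleFunc Plane ℝ≥0∞ := fun n => (SimpleFunc.eapprox f n).restrict (S n) with hg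
  have hgm : Monotone g := by
    intro m n hmn x
    simp only [hg, SimpleFunc.restrict_apply _ (hS _)]
    exact Set.indicator_le_indicator_of_subset (monotone_spanningSets _ hmn) (fun _ => zero_le) x
      |>.trans (Set.indicator_le_indicator (SimpleFunc.monotone_eapprox f hmn x))
  have hsup : ∀ x, Tendsto (fun n => g n x) atTop (𝓝 (f x)) := by
    intro x
    refine (SimpleFunc.tendsto_eapprox hf x).congr' ?_
    have : x ∈ ⋃ n, S n := by simp [S, iUnion_spanningSets]
    obtain ⟨n, hn⟩ := Set.mem_iUnion.1 this
    filter_upwards [eventually_ge_atTop n] with m hm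
    rw [hg, SimpleFunc.restrict_apply _ (hS _),
      Set.indicator_of_mem (monotone_spanningSets _ hm hn)]
  have hlap : ∀ n, _ := fun n => h.laplace_simpleFunc hl (g n)
    (fun x => by
      rw [hg, SimpleFunc.restrict_apply _ (hS _)]
      by_cases hx : x ∈ S n
      · rw [Set.indicator_of_mem hx]; exact (SimpleFunc.eapprox_lt_top f n x).ne
      · simp [hx])
    (fun c hc => by
      rw [hg, SimpleFunc.restrict_preimage_singleton _ (hS _) hc]
      exact measure_ne_top_of_subset Set.inter_subset_left (measure_spanningSets_lt_top _ n).ne)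
  have hleft : Tendsto (fun n => ∫⁻ ω, expNeg (∑' i, g n (X i ω)) ∂μ) atTop
      (𝓝 (∫⁻ ω, expNeg (∑' i, f (X i ω)) ∂μ)) := by
    refine tendsto_lintegral_of_dominated_convergence (fun _ => 1) (fun n => ?_)
      (fun n => ae_of_all _ fun ω => expNeg_le_one _) (by simp) (ae_of_all _ fun ω => ?_)
    · exact measurable_expNeg.comp
        (Measurable.tsum fun i => (g n).measurable.comp (h.measurable i))
    · refine (continuous_expNeg.tendsto _).comp ?_
      -- The series becomes an integral against counting measure, so that monotone convergence
      -- applies to it.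
      simp only [← MeasureTheory.lintegral_count]
      exact lintegral_tendsto_of_tendsto_of_monotone (fun n => measurable_of_countable _ |>.aemeasurable)
        (ae_of_all _ fun i m n hmn => hgm hmn _) (ae_of_all _ fun i => hsup _)
  have hright : Tendsto (fun n => expNeg (ENNReal.ofReal lamB * ∫⁻ x, (1 - expNeg (g n x)))) atTop
      (𝓝 (expNeg (ENNReal.ofReal lamB * ∫⁻ x, (1 - expNeg (f x))))) := by
    refine (continuous_expNeg.tendsto _).comp (ENNReal.Tendsto.const_mul ?_ (by simp))
    refine lintegral_tendsto_of_tendsto_of_monotone (fun n => ?_) (ae_of_all _ fun x => ?_)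
      (ae_of_all _ fun x => ?_)
    · have := (g n).measurable
      fun_prop
    · exact fun m n hmn => tsub_le_tsub_left (antitone_expNeg (hgm hmn x)) _
    · exact ENNReal.Tendsto.sub tendsto_const_nhds ((continuous_expNeg.tendsto _).comp (hsup x))
        (by simp)
  simp_rw [hlap] at hleft
  exact tendsto_nhds_unique hleft hright

end IsHomogeneousPPP

end FDNetwork

/-! ### Differentiating the Laplace functional; the reduced Campbell formula -/

namespace FDNetwork

open Filter Topology

/-- Difference quotients along the sequence `1 / (n + 1)` stand in for the derivative at `0`, so
that sequential dominated convergence can be used below. -/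
lemma tendsto_mul_of_hasDerivAt {g : ℝ → ℝ} {b : ℝ} (h0 : g 0 = 0) (hg : HasDerivAt g b 0) :
    Tendsto (fun n : ℕ => ((n : ℝ) + 1) * g (1 / ((n : ℝ) + 1))) atTop (𝓝 b) := by
  have h1 : Tendsto (fun n : ℕ => 1 / ((n : ℝ) + 1)) atTop (𝓝[≠] 0) :=
    tendsto_nhdsWithin_iff.2 ⟨tendsto_one_div_add_atTop_nhds_zero_nat,
      Eventually.of_forall fun n => by simp; positivity⟩
  have h2 := hg.tendsto_slope_zero.comp h1
  refine h2.congr fun n => ?_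
  simp [h0]

lemma tendsto_one_sub_expNeg_mul {x : ℝ≥0∞} (hx : x ≠ ∞) :
    Tendsto (fun n : ℕ => ((n : ℝ≥0∞) + 1) * (1 - expNeg (ENNReal.ofReal (1 / ((n : ℝ) + 1)) * x)))
      atTop (𝓝 x) := by
  have hd : HasDerivAt (fun t : ℝ => 1 - Real.exp (-(t * x.toReal))) x.toReal 0 := by
    have := ((((hasDerivAt_id (0 : ℝ)).mul_const x.toReal).neg).exp).const_sub 1
    simpa using this
  have := (ENNReal.continuous_ofReal.tendsto _).comp (tendsto_mul_of_hasDerivAt (by simp) hd)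
  rw [ENNReal.ofReal_toReal hx] at this
  refine this.congr fun n => ?_
  have hn : (0 : ℝ) ≤ (n : ℝ) + 1 := by positivity
  rw [Function.comp_apply, ENNReal.ofReal_mul hn, ENNReal.ofReal_add (by simp) (by simp),
    ENNReal.ofReal_natCast, ENNReal.ofReal_one, ENNReal.ofReal_sub _ (Real.exp_pos _).le,
    ← expNeg_ofReal (by positivity), ENNReal.ofReal_mul (by positivity), ENNReal.ofReal_toReal hx,
    ENNReal.ofReal_one]

lemma tendsto_one_sub_expNeg_one_sub {x : ℝ≥0∞} (hx : x ≠ ∞) :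
    Tendsto (fun n : ℕ => ((n : ℝ≥0∞) + 1) *
        (1 - expNeg (x * (1 - expNeg (ENNReal.ofReal (1 / ((n : ℝ) + 1)))))))
      atTop (𝓝 x) := by
  have hd : HasDerivAt (fun t : ℝ => 1 - Real.exp (-(x.toReal * (1 - Real.exp (-t))))) x.toReal 0 := by
    have := (((((hasDerivAt_id (0 : ℝ)).neg.exp.const_sub 1).const_mul x.toReal).neg).exp).const_sub 1
    simpa using this
  have := (ENNReal.continuous_ofReal.tendsto _).comp (tendsto_mul_of_hasDerivAt (by simp) hd)
  rw [ENNReal.ofReal_toReal hx] at this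
  refine this.congr fun n => ?_
  have hn : (0 : ℝ) ≤ (n : ℝ) + 1 := by positivity
  have h1 : (0 : ℝ) ≤ 1 - Real.exp (-(1 / ((n : ℝ) + 1))) := by
    simp; positivity
  rw [Function.comp_apply, ENNReal.ofReal_mul hn, ENNReal.ofReal_add (by simp) (by simp),
    ENNReal.ofReal_natCast, ENNReal.ofReal_one, ENNReal.ofReal_sub _ (Real.exp_pos _).le,
    ← expNeg_ofReal (by positivity), ENNReal.ofReal_mul (by positivity), ENNReal.ofReal_toReal hx,
    ENNReal.ofReal_one, ENNReal.ofReal_sub _ (Real.exp_pos _).le, ← expNeg_ofReal (by positivity),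
    ENNReal.ofReal_one]

variable {Ω : Type*} [MeasurableSpace Ω] {μ : Measure Ω} {lamB : ℝ} {X : ℕ → Ω → Plane}

namespace IsHomogeneousPPP

lemma ae_count_lt_top (h : IsHomogeneousPPP μ lamB X) (hl : 0 ≤ lamB) {B : Set Plane}
    (hB : MeasurableSet B) (hB' : volume B ≠ ∞) : ∀ᵐ ω ∂μ, count X B ω < ∞ := by
  refine ae_lt_top (measurable_count h.measurable hB) ?_
  rw [h.lintegral_count hl hB hB']
  exact ENNReal.mul_ne_top (by simp) hB'

lemma measurable_tsum (h : IsHomogeneousPPP μ lamB X) {f : Plane → ℝ≥0∞} (hf : Measurable f) :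
    Measurable fun ω => ∑' i, f (X i ω) :=
  Measurable.tsum fun i => hf.comp (h.measurable i)

/-- This is the derivative at `t = 0` of the Laplace functional of `f + t 1_A`, up to sign: under
the expectation it brings down `N(A)`, in the closed form `λ_b ∫_A e^{-f}`. -/
lemma lintegral_count_mul_expNeg (h : IsHomogeneousPPP μ lamB X) (hl : 0 ≤ lamB)
    [IsProbabilityMeasure μ] {f : Plane → ℝ≥0∞} (hf : Measurable f) {A : Set Plane}
    (hA : MeasurableSet A) (hA' : volume A ≠ ∞) :
    ∫⁻ ω, count X A ω * expNeg (∑' i, f (X i ω)) ∂μ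
      = ENNReal.ofReal lamB * (∫⁻ x in A, expNeg (f x))
        * expNeg (ENNReal.ofReal lamB * ∫⁻ x, (1 - expNeg (f x))) := by
  set t : ℕ → ℝ≥0∞ := fun n => ENNReal.ofReal (1 / ((n : ℝ) + 1)) with ht
  set C := expNeg (ENNReal.ofReal lamB * ∫⁻ x, (1 - expNeg (f x))) with hC
  set a := ∫⁻ x in A, expNeg (f x) with ha
  have ha' : a ≠ ∞ := by
    refine ((lintegral_mono (fun x => expNeg_le_one (f x))).trans_lt ?_).ne
    simpa using hA'.lt_top
  have hSm := h.measurable_tsum hf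
  have hNm := measurable_count h.measurable hA
  have hpert : ∀ n, ∫⁻ ω, expNeg (∑' i, f (X i ω)) * expNeg (t n * count X A ω) ∂μ
      = C * expNeg (ENNReal.ofReal lamB * a * (1 - expNeg (t n))) := by
    intro n
    have hfn : Measurable fun x => f x + t n * A.indicator (fun _ => (1 : ℝ≥0∞)) x :=
      hf.add (measurable_const.mul (measurable_const.indicator hA))
    have h1 := h.laplace hl hfn
    simp_rw [ENNReal.tsum_add, ENNReal.tsum_mul_left, expNeg_add] at h1
    refine h1.trans ?_
    -- On `A` this is `1 - e^{-f} e^{-t} = (1 - e^{-f}) + e^{-f} (1 - e^{-t})`; off `A` the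
    -- perturbation is absent. Hence the exponent splits and `C` factors out.
    have h2 : ∀ x, 1 - expNeg (f x) * expNeg (t n * A.indicator (fun _ => (1 : ℝ≥0∞)) x)
        = (1 - expNeg (f x)) + A.indicator (fun x => expNeg (f x) * (1 - expNeg (t n))) x := by
      intro x
      by_cases hx : x ∈ A
      · simp only [Set.indicator_of_mem hx, mul_one]
        rw [ENNReal.mul_sub (fun _ _ => expNeg_ne_top _), mul_one]
        exact (tsub_add_tsub_cancel (expNeg_le_one _) (mul_le_of_le_one_right' (expNeg_le_one _))).symm
      · simp [Set.indicator_of_notMem hx, expNeg_zero]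
    simp_rw [h2]
    rw [lintegral_add_left (by fun_prop), lintegral_indicator hA, lintegral_mul_const _ (by fun_prop),
      mul_add, expNeg_add, ← mul_assoc]
  have hlap : ∫⁻ ω, expNeg (∑' i, f (X i ω)) ∂μ = C := h.laplace hl hf
  have hC' : C ≠ ∞ := expNeg_ne_top _
  have hdiff : ∀ n : ℕ, ∫⁻ ω, expNeg (∑' i, f (X i ω))
      * (((n : ℝ≥0∞) + 1) * (1 - expNeg (t n * count X A ω))) ∂μ
      = C * (((n : ℝ≥0∞) + 1) * (1 - expNeg (ENNReal.ofReal lamB * a * (1 - expNeg (t n))))) := by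
    intro n
    have h1 : ∀ ω, expNeg (∑' i, f (X i ω)) * (((n : ℝ≥0∞) + 1) * (1 - expNeg (t n * count X A ω)))
        = ((n : ℝ≥0∞) + 1) * (expNeg (∑' i, f (X i ω))
          - expNeg (∑' i, f (X i ω)) * expNeg (t n * count X A ω)) := by
      intro ω
      rw [mul_left_comm, ENNReal.mul_sub (fun _ _ => expNeg_ne_top _), mul_one]
    simp_rw [h1]
    rw [lintegral_const_mul _ (by fun_prop), lintegral_sub (by fun_prop), hpert, hlap,
      mul_left_comm C, ENNReal.mul_sub (fun _ _ => hC'), mul_one]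
    · rw [hpert]; exact ENNReal.mul_ne_top hC' (expNeg_ne_top _)
    · exact ae_of_all _ fun ω => mul_le_of_le_one_right' (expNeg_le_one _)
  have hr : Tendsto (fun n : ℕ => C * (((n : ℝ≥0∞) + 1)
      * (1 - expNeg (ENNReal.ofReal lamB * a * (1 - expNeg (t n)))))) atTop
      (𝓝 (C * (ENNReal.ofReal lamB * a))) :=
    ENNReal.Tendsto.const_mul
      (tendsto_one_sub_expNeg_one_sub (ENNReal.mul_ne_top (by simp) ha')) (Or.inr hC')
  have hl' : Tendsto (fun n : ℕ => ∫⁻ ω, expNeg (∑' i, f (X i ω))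
      * (((n : ℝ≥0∞) + 1) * (1 - expNeg (t n * count X A ω))) ∂μ) atTop
      (𝓝 (∫⁻ ω, expNeg (∑' i, f (X i ω)) * count X A ω ∂μ)) := by
    -- Since `1 - e^{-x} ≤ x`, the difference quotients are at most `N(A)`, whose mean is finite.
    refine tendsto_lintegral_of_dominated_convergence (count X A) (fun n => by fun_prop)
      (fun n => ae_of_all _ fun ω => ?_) ?_ ?_
    · refine (mul_le_of_le_one_left' (expNeg_le_one _)).trans ?_
      refine (mul_le_mul_right ((one_sub_expNeg_le _).trans (min_le_right _ _)) _).trans ?_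
      rw [← mul_assoc]
      refine mul_le_of_le_one_left' ?_
      have hn : (0 : ℝ) ≤ (n : ℝ) + 1 := by positivity
      rw [← ENNReal.ofReal_natCast, ← ENNReal.ofReal_one, ← ENNReal.ofReal_add (by simp) (by simp),
        ht, ← ENNReal.ofReal_mul hn]
      refine ENNReal.ofReal_le_ofReal (le_of_eq ?_)
      field_simp
    · rw [h.lintegral_count hl hA hA']
      exact ENNReal.mul_ne_top (by simp) hA'
    · filter_upwards [h.ae_count_lt_top hl hA hA'] with ω hω
      exact ENNReal.Tendsto.const_mul (tendsto_one_sub_expNeg_mul hω.ne)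
        (Or.inr (expNeg_ne_top _))
  simp_rw [hdiff] at hl'
  simp_rw [mul_comm (count X A _)]
  rw [tendsto_nhds_unique hl' hr, mul_comm]

/-- The reduced Campbell formula for a functional that does not depend on the removed point. -/
lemma lintegral_tsum_mul_expNeg (h : IsHomogeneousPPP μ lamB X) (hl : 0 ≤ lamB)
    [IsProbabilityMeasure μ] {g f : Plane → ℝ≥0∞} (hg : Measurable g) (hf : Measurable f)
    (hf' : ∀ x, f x ≠ ∞) :
    ∫⁻ ω, ∑' i, g (X i ω) * expNeg (∑' j, if j = i then 0 else f (X j ω)) ∂μ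
      = ENNReal.ofReal lamB * (∫⁻ x, g x)
        * expNeg (ENNReal.ofReal lamB * ∫⁻ x, (1 - expNeg (f x))) := by
  set C := expNeg (ENNReal.ofReal lamB * ∫⁻ x, (1 - expNeg (f x))) with hC
  have hSm := h.measurable_tsum hf
  have hpos : ∀ x, expNeg (f x) ≠ 0 := fun x => by simpa [expNeg_eq_zero_iff] using hf' x
  have hXm := h.measurable
  -- `κ A` is `E [N(A) exp (-∑ f)]`. The previous lemma identifies it with `κ'` on sets of finite
  -- area, and exhaustion of the plane extends this to all Borel sets.
  set κ : Measure Plane := Measure.sum fun i =>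
    (μ.withDensity fun ω => expNeg (∑' j, f (X j ω))).map (X i) with hκ
  have hκl : ∀ k : Plane → ℝ≥0∞, Measurable k → ∫⁻ x, k x ∂κ
      = ∫⁻ ω, (∑' i, k (X i ω)) * expNeg (∑' j, f (X j ω)) ∂μ := by
    intro k hk
    rw [hκ, lintegral_sum_measure]
    simp_rw [← ENNReal.tsum_mul_right]
    rw [lintegral_tsum (fun i => by have := hXm i; fun_prop)]
    refine tsum_congr fun i => ?_
    have := hXm i
    rw [lintegral_map hk this, lintegral_withDensity_eq_lintegral_mul _ (by fun_prop) (by fun_prop)]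
    refine lintegral_congr fun ω => ?_
    simp [mul_comm]
  set κ' : Measure Plane := (ENNReal.ofReal lamB * C) • volume.withDensity (fun x => expNeg (f x))
  have hfin : ∀ A, MeasurableSet A → volume A ≠ ∞ → κ A = κ' A := by
    intro A hA hA'
    rw [← lintegral_indicator_one hA, hκl _ (measurable_one.indicator hA)]
    refine (h.lintegral_count_mul_expNeg hl hf hA hA').trans ?_
    simp only [κ', Measure.smul_apply, smul_eq_mul, withDensity_apply _ hA]
    ring
  have hκκ : κ = κ' := by
    refine Measure.ext fun A hA => ?_
    have hU : A = ⋃ n, A ∩ spanningSets (volume : Measure Plane) n := by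
      rw [← Set.inter_iUnion, iUnion_spanningSets, Set.inter_univ]
    have hmono : Monotone fun n => A ∩ spanningSets (volume : Measure Plane) n :=
      fun m n hmn => Set.inter_subset_inter_right _ (monotone_spanningSets _ hmn)
    rw [hU, hmono.measure_iUnion, hmono.measure_iUnion]
    refine iSup_congr fun n => hfin _ (hA.inter (measurableSet_spanningSets _ _)) ?_
    exact measure_ne_top_of_subset Set.inter_subset_right (measure_spanningSets_lt_top _ n).ne
  -- Testing against `g e^f` cancels the factor `e^{-f(x_i)}` of the distinguished point. The
  -- division is legitimate because `f` is finite.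
  have hk : Measurable fun x => g x * (expNeg (f x))⁻¹ := by fun_prop
  have hmain := hκl _ hk
  rw [hκκ] at hmain
  have hpt : ∀ ω, ∑' i, g (X i ω) * expNeg (∑' j, if j = i then 0 else f (X j ω))
      = (∑' i, g (X i ω) * (expNeg (f (X i ω)))⁻¹) * expNeg (∑' j, f (X j ω)) := by
    intro ω
    rw [← ENNReal.tsum_mul_right]
    refine tsum_congr fun i => ?_
    rw [ENNReal.tsum_eq_add_tsum_ite (f := fun j => f (X j ω)) i, expNeg_add, mul_assoc, ← mul_assoc _⁻¹,
      ENNReal.inv_mul_cancel (hpos _) (expNeg_ne_top _), one_mul]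
    congr! 4
    split_ifs <;> rfl
  simp_rw [hpt]
  rw [← hmain, lintegral_smul_measure, lintegral_withDensity_eq_lintegral_mul _ (by fun_prop) hk,
    smul_eq_mul]
  have : ∀ x, ((fun x => expNeg (f x)) * fun x => g x * (expNeg (f x))⁻¹) x = g x := by
    intro x
    rw [Pi.mul_apply, mul_left_comm, ENNReal.mul_inv_cancel (hpos _) (expNeg_ne_top _), mul_one]
  simp_rw [this]
  ring

end IsHomogeneousPPP

end FDNetwork

/-! ### Averaging over independent marks; the displaced typical point -/

namespace FDNetwork

open Filter Topology

section Resampling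

variable {E : Type*} [MeasurableSpace E] (ρ : Measure E) [IsProbabilityMeasure ρ]

lemma measurable_update_prod (i : ℕ) :
    Measurable fun q : E × (ℕ → E) => Function.update q.2 i q.1 := by
  refine measurable_pi_iff.2 fun j => ?_
  by_cases h : j = i
  · subst h; simpa using measurable_fst
  · simp only [Function.update_of_ne h]; fun_prop

/-- Resampling one coordinate by an independent copy preserves the product law; this lets Fubini
separate the mark of the typical point from all the others. -/
lemma map_update_infinitePi (i : ℕ) :
    (ρ.prod (Measure.infinitePi fun _ : ℕ => ρ)).map (fun q => Function.update q.2 i q.1)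
      = Measure.infinitePi fun _ : ℕ => ρ := by
  classical
  refine Measure.eq_infinitePi _ fun s t ht => ?_
  rw [Measure.map_apply (measurable_update_prod i)
    (MeasurableSet.pi s.countable_toSet fun j _ => ht j)]
  have hpre : (fun q : E × (ℕ → E) => Function.update q.2 i q.1) ⁻¹' Set.pi s t
      = (if i ∈ s then t i else Set.univ) ×ˢ Set.pi (s.erase i : Finset ℕ) t := by
    ext q
    simp only [Set.mem_preimage, Set.mem_pi, Finset.mem_coe, Set.mem_prod, Finset.mem_erase]
    constructor
    · intro h
      refine ⟨?_, fun j hj => by simpa [Function.update_of_ne hj.1] using h j hj.2⟩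
      split_ifs with hi
      · simpa using h i hi
      · trivial
    · rintro ⟨h1, h2⟩ j hj
      rcases eq_or_ne j i with rfl | hji
      · simpa [hj] using h1
      · simpa [Function.update_of_ne hji] using h2 j ⟨hji, hj⟩
  rw [hpre, Measure.prod_prod, Measure.infinitePi_pi _ (fun j _ => ht j)]
  split_ifs with hi
  · exact Finset.mul_prod_erase s (fun j => ρ (t j)) hi
  · rw [Finset.erase_eq_of_notMem hi, measure_univ, one_mul]

/-- Independence gives the product formula for finitely many marks, and bounded convergence gives
the rest. Writing the factors through `negLog` keeps the result a series instead of an infinite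
product. -/
lemma lintegral_expNeg_tsum_infinitePi (ψ : ℕ → E → ℝ≥0∞) (hψ : ∀ j, Measurable (ψ j)) :
    ∫⁻ m, expNeg (∑' j, ψ j (m j)) ∂(Measure.infinitePi fun _ : ℕ => ρ)
      = expNeg (∑' j, negLog (∫⁻ b, expNeg (ψ j b) ∂ρ)) := by
  set Q := Measure.infinitePi fun _ : ℕ => ρ
  have hmψ : ∀ j, Measurable fun m : ℕ → E => ψ j (m j) := fun j => by
    have := hψ j
    fun_prop
  have hle : ∀ j, ∫⁻ b, expNeg (ψ j b) ∂ρ ≤ 1 := fun j => by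
    simpa using lintegral_mono (μ := ρ) fun b => expNeg_le_one (ψ j b)
  have hfin : ∀ n, ∫⁻ m, expNeg (∑ j ∈ Finset.range n, ψ j (m j)) ∂Q
      = expNeg (∑ j ∈ Finset.range n, negLog (∫⁻ b, expNeg (ψ j b) ∂ρ)) := by
    intro n
    simp_rw [expNeg_sum, expNeg_negLog (hle _)]
    rw [lintegral_prod_eq_prod_lintegral_of_indepFun (Finset.range n)
      (fun j (m : ℕ → E) => expNeg (ψ j (m j)))
      (iIndepFun_infinitePi fun j => measurable_expNeg.comp (hψ j))
      (fun j => measurable_expNeg.comp (hmψ j))]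
    refine Finset.prod_congr rfl fun j _ => ?_
    exact (measurePreserving_eval_infinitePi (fun _ : ℕ => ρ) j).lintegral_comp
      (measurable_expNeg.comp (hψ j))
  have hr : Tendsto (fun n => expNeg (∑ j ∈ Finset.range n, negLog (∫⁻ b, expNeg (ψ j b) ∂ρ)))
      atTop (𝓝 (expNeg (∑' j, negLog (∫⁻ b, expNeg (ψ j b) ∂ρ)))) :=
    (continuous_expNeg.tendsto _).comp (ENNReal.tendsto_nat_tsum _)
  have hl : Tendsto (fun n => ∫⁻ m, expNeg (∑ j ∈ Finset.range n, ψ j (m j)) ∂Q) atTop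
      (𝓝 (∫⁻ m, expNeg (∑' j, ψ j (m j)) ∂Q)) :=
    tendsto_lintegral_of_dominated_convergence (fun _ => 1)
      (fun n => measurable_expNeg.comp (Finset.measurable_fun_sum _ fun j _ => hmψ j))
      (fun n => ae_of_all _ fun ω => expNeg_le_one _) (by simp)
      (ae_of_all _ fun m => (continuous_expNeg.tendsto _).comp (ENNReal.tendsto_nat_tsum _))
  simp_rw [hfin] at hl
  exact tendsto_nhds_unique hl hr

lemma lintegral_expNeg_tsum_ne_infinitePi (i : ℕ) (ψ : ℕ → E → E → ℝ≥0∞)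
    (hψ : ∀ j, Measurable (Function.uncurry (ψ j))) :
    ∫⁻ m, expNeg (∑' j, if j = i then 0 else ψ j (m i) (m j)) ∂(Measure.infinitePi fun _ : ℕ => ρ)
      = ∫⁻ a, expNeg (∑' j, if j = i then 0 else negLog (∫⁻ b, expNeg (ψ j a b) ∂ρ)) ∂ρ := by
  have hite : ∀ j, Measurable fun q : E × E => if j = i then 0 else ψ j q.1 q.2 := fun j => by
    split_ifs
    · fun_prop
    · exact hψ j
  have hmeas : Measurable fun m : ℕ → E =>
      expNeg (∑' j, if j = i then 0 else ψ j (m i) (m j)) :=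
    measurable_expNeg.comp (Measurable.tsum fun j => by
      have h2 : Measurable fun m : ℕ → E => (m i, m j) := by fun_prop
      exact (hite j).comp h2)
  rw [← map_update_infinitePi ρ i, lintegral_map hmeas (measurable_update_prod i),
    lintegral_prod _ (by exact (hmeas.comp (measurable_update_prod i)).aemeasurable)]
  refine lintegral_congr fun a => ?_
  have h1 : ∀ m : ℕ → E, (∑' j, if j = i then 0
        else ψ j (Function.update m i a i) (Function.update m i a j))
      = ∑' j, (fun b => if j = i then 0 else ψ j a b) (m j) := fun m => tsum_congr fun j => by
    split_ifs with h
    · rfl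
    · simp [Function.update_of_ne h]
  simp_rw [h1]
  rw [lintegral_expNeg_tsum_infinitePi ρ (fun j b => if j = i then 0 else ψ j a b)
    (fun j => (hite j).comp (measurable_const.prodMk measurable_id))]
  congr 1
  refine tsum_congr fun j => ?_
  split_ifs
  · simp [expNeg_zero, negLog]
  · rfl

end Resampling

variable {Ω E : Type*} [MeasurableSpace Ω] [MeasurableSpace E] {μ : Measure Ω} {lamB : ℝ}
  {X : ℕ → Ω → Plane}

/-- The Laplace transform, under the Palm distribution, of a shot noise with i.i.d. marks that is
observed at a randomly displaced typical point. -/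
theorem IsHomogeneousPPP.palm_laplace_marked (h : IsHomogeneousPPP μ lamB X) (hl : 0 ≤ lamB)
    [IsProbabilityMeasure μ] {ρ : Measure E} [IsProbabilityMeasure ρ] {M : ℕ → Ω → E}
    (hMm : ∀ i, Measurable (M i)) (hMl : ∀ i, μ.map (M i) = ρ) (hMi : iIndepFun M μ)
    (hXM : IndepFun (fun ω i => X i ω) (fun ω i => M i ω) μ)
    {d : E → Plane} (hd : Measurable d) (hdac : ρ.map d ≪ volume)
    {g : Plane → E → ℝ≥0∞} (hg : Measurable (Function.uncurry g)) (hg' : ∀ z b, g z b ≠ ∞)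
    {W : Set Plane} (hW : MeasurableSet W) :
    ∫⁻ ω, ∑' i, W.indicator 1 (X i ω) *
        expNeg (∑' j, if j = i then 0 else g (X j ω - (X i ω + d (M i ω))) (M j ω)) ∂μ
      = ENNReal.ofReal lamB * volume W *
        expNeg (ENNReal.ofReal lamB * ∫⁻ z, (1 - ∫⁻ b, expNeg (g z b) ∂ρ)) := by
  -- `F` is the effective contribution of a point after its mark is averaged out. It is finite
  -- because `e^{-g}` is positive, as the reduced Campbell formula requires.
  set F : Plane → ℝ≥0∞ := fun z => negLog (∫⁻ b, expNeg (g z b) ∂ρ) with hF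
  have hGm : Measurable fun z => ∫⁻ b, expNeg (g z b) ∂ρ :=
    (measurable_expNeg.comp hg).lintegral_prod_right'
  have hG1 : ∀ z, ∫⁻ b, expNeg (g z b) ∂ρ ≤ 1 := fun z => by
    simpa using lintegral_mono (μ := ρ) fun b => expNeg_le_one (g z b)
  have hG0 : ∀ z, ∫⁻ b, expNeg (g z b) ∂ρ ≠ 0 := fun z h0 => by
    have hgz : Measurable (g z) := hg.comp (measurable_const.prodMk measurable_id)
    rw [lintegral_eq_zero_iff (by fun_prop)] at h0
    obtain ⟨b, hb⟩ := h0.exists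
    exact hg' z b (expNeg_eq_zero_iff.1 hb)
  have hFm : Measurable F := measurable_negLog.comp hGm
  have hF' : ∀ z, F z ≠ ∞ := fun z => negLog_ne_top (hG1 z) (hG0 z)
  have hFe : ∀ z, expNeg (F z) = ∫⁻ b, expNeg (g z b) ∂ρ := fun z => expNeg_negLog (hG1 z)
  have hXm := h.measurable
  have hX' : Measurable fun ω i => X i ω := measurable_pi_iff.2 hXm
  have hM' : Measurable fun ω i => M i ω := measurable_pi_iff.2 hMm
  have hlaw : μ.map (fun ω => ((fun i => X i ω), fun i => M i ω))
      = (μ.map fun ω i => X i ω).prod (Measure.infinitePi fun _ : ℕ => ρ) := by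
    rw [(indepFun_iff_map_prod_eq_prod_map_map hX'.aemeasurable hM'.aemeasurable).1 hXM,
      hMi.map_fun_eq_infinitePi_map hMm]
    simp_rw [hMl]
  have hWm : Measurable (W.indicator (1 : Plane → ℝ≥0∞)) := measurable_one.indicator hW
  have hW1 : ∀ x, W.indicator (1 : Plane → ℝ≥0∞) x ≠ ∞ := fun x =>
    ((Set.indicator_le_self' (f := (1 : Plane → ℝ≥0∞)) (fun _ _ => zero_le) x).trans_lt
      ENNReal.one_lt_top).ne
  set p : Plane → ℝ≥0∞ := (ρ.map d).rnDeriv volume with hp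
  have hpm : Measurable p := Measure.measurable_rnDeriv _ _
  have : IsProbabilityMeasure (ρ.map d) := Measure.isProbabilityMeasure_map hd.aemeasurable
  have hpd : volume.withDensity p = ρ.map d := Measure.withDensity_rnDeriv_eq _ _ hdac
  have hp1 : ∫⁻ y, p y = 1 := by
    rw [← setLIntegral_univ, ← withDensity_apply _ MeasurableSet.univ, hpd, measure_univ]
  -- With the points fixed, the other marks are averaged into `F`; the displacement of point `i` is
  -- then integrated against its density, and the shift by `x i` makes the UE location `y` the
  -- variable.
  have hstep : ∀ i, ∫⁻ ω, W.indicator 1 (X i ω) *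
        expNeg (∑' j, if j = i then 0 else g (X j ω - (X i ω + d (M i ω))) (M j ω)) ∂μ
      = ∫⁻ ω, (∫⁻ y, W.indicator 1 (X i ω) * p (y - X i ω) *
        expNeg (∑' j, if j = i then 0 else F (X j ω - y))) ∂μ := by
    intro i
    have hm1 : Measurable fun q : (ℕ → Plane) × (ℕ → E) => W.indicator 1 (q.1 i) *
        expNeg (∑' j, if j = i then 0 else g (q.1 j - (q.1 i + d (q.2 i))) (q.2 j)) := by
      refine (hWm.comp (by fun_prop)).mul (measurable_expNeg.comp (Measurable.tsum fun j => ?_))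
      split_ifs
      · fun_prop
      · exact hg.comp (Measurable.prodMk (by fun_prop) (by fun_prop))
    have hm2 : Measurable fun x : ℕ → Plane => ∫⁻ y, W.indicator 1 (x i) * p (y - x i) *
        expNeg (∑' j, if j = i then 0 else F (x j - y)) := by
      refine Measurable.lintegral_prod_right' (f := fun q : (ℕ → Plane) × Plane =>
        W.indicator 1 (q.1 i) * p (q.2 - q.1 i) *
        expNeg (∑' j, if j = i then 0 else F (q.1 j - q.2))) ?_
      refine ((hWm.comp (by fun_prop)).mul (hpm.comp (by fun_prop))).mul
        (measurable_expNeg.comp (Measurable.tsum fun j => ?_))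
      split_ifs
      · fun_prop
      · exact hFm.comp (by fun_prop)
    have e1 : ∫⁻ ω, W.indicator 1 (X i ω) *
        expNeg (∑' j, if j = i then 0 else g (X j ω - (X i ω + d (M i ω))) (M j ω)) ∂μ
        = ∫⁻ q, W.indicator 1 (q.1 i) *
          expNeg (∑' j, if j = i then 0 else g (q.1 j - (q.1 i + d (q.2 i))) (q.2 j))
          ∂(μ.map (fun ω => ((fun i => X i ω), fun i => M i ω))) := by
      rw [lintegral_map hm1 (hX'.prodMk hM')]
    rw [e1, hlaw, lintegral_prod _ hm1.aemeasurable, ← lintegral_map hm2 hX']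
    refine lintegral_congr fun x => ?_
    have hm3 : ∀ j, Measurable (Function.uncurry fun a b : E => g (x j - (x i + d a)) b) :=
      fun j => hg.comp (Measurable.prodMk (by fun_prop) (by fun_prop))
    have hm4 : Measurable fun y => expNeg (∑' j, if j = i then 0 else F (x j - (x i + y))) := by
      refine measurable_expNeg.comp (Measurable.tsum fun j => ?_)
      split_ifs
      · fun_prop
      · exact hFm.comp (by fun_prop)
    dsimp only
    rw [lintegral_const_mul', lintegral_expNeg_tsum_ne_infinitePi ρ i _ hm3,
      ← lintegral_map (g := d) (f := fun y => expNeg (∑' j, if j = i then 0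
        else F (x j - (x i + y)))) hm4 hd, ← hpd, lintegral_withDensity_eq_lintegral_mul _ hpm hm4,
      ← lintegral_sub_right_eq_self _ (x i)]
    · rw [← lintegral_const_mul']
      · refine lintegral_congr fun y => ?_
        simp [mul_assoc]
      · exact hW1 _
    · exact hW1 _
  have hmω : ∀ i, Measurable fun ω => W.indicator 1 (X i ω) *
        expNeg (∑' j, if j = i then 0 else g (X j ω - (X i ω + d (M i ω))) (M j ω)) := by
    intro i
    refine (hWm.comp (hXm i)).mul (measurable_expNeg.comp (Measurable.tsum fun j => ?_))
    have := hXm i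
    have := hXm j
    have := hMm i
    split_ifs
    · fun_prop
    · exact hg.comp (Measurable.prodMk (by fun_prop) (hMm j))
  have hmωy : ∀ i, Measurable fun q : Ω × Plane => W.indicator 1 (X i q.1) * p (q.2 - X i q.1) *
        expNeg (∑' j, if j = i then 0 else F (X j q.1 - q.2)) := by
    intro i
    have := hXm i
    refine ((hWm.comp (by fun_prop)).mul (hpm.comp (by fun_prop))).mul
      (measurable_expNeg.comp (Measurable.tsum fun j => ?_))
    have := hXm j
    split_ifs
    · fun_prop
    · exact hFm.comp (by fun_prop)
  rw [lintegral_tsum fun i => (hmω i).aemeasurable]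
  simp_rw [hstep]
  rw [← lintegral_tsum fun i => ((hmωy i).lintegral_prod_right').aemeasurable]
  have e2 : ∀ ω, ∑' i, ∫⁻ y, W.indicator 1 (X i ω) * p (y - X i ω) *
        expNeg (∑' j, if j = i then 0 else F (X j ω - y))
      = ∫⁻ y, ∑' i, W.indicator 1 (X i ω) * p (y - X i ω) *
        expNeg (∑' j, if j = i then 0 else F (X j ω - y)) := fun ω =>
    (lintegral_tsum fun i => ((hmωy i).comp (measurable_const.prodMk measurable_id)).aemeasurable).symm
  simp_rw [e2]
  rw [lintegral_lintegral_swap (Measurable.tsum hmωy).aemeasurable]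
  -- With `y` frozen, `F (· - y)` is a fixed function of the plane, and translation invariance
  -- removes `y` from the exponent.
  have e3 : ∀ y, ∫⁻ ω, ∑' i, W.indicator 1 (X i ω) * p (y - X i ω) *
        expNeg (∑' j, if j = i then 0 else F (X j ω - y)) ∂μ
      = ENNReal.ofReal lamB * (∫⁻ x, W.indicator 1 x * p (y - x)) *
        expNeg (ENNReal.ofReal lamB * ∫⁻ z, (1 - ∫⁻ b, expNeg (g z b) ∂ρ)) := by
    intro y
    rw [h.lintegral_tsum_mul_expNeg hl (g := fun x => W.indicator 1 x * p (y - x))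
      (f := fun x => F (x - y)) (hWm.mul (hpm.comp (by fun_prop))) (hFm.comp (by fun_prop))
      (fun x => hF' _)]
    rw [lintegral_sub_right_eq_self (fun x => 1 - expNeg (F x)) y]
    simp_rw [hFe]
  have hm5 : Measurable fun q : Plane × Plane => W.indicator 1 q.2 * p (q.1 - q.2) :=
    (hWm.comp (by fun_prop)).mul (hpm.comp (by fun_prop))
  have hm6 : Measurable fun y => ∫⁻ x, W.indicator 1 x * p (y - x) := hm5.lintegral_prod_right'
  simp_rw [e3]
  rw [lintegral_mul_const _ (hm6.const_mul _), lintegral_const_mul _ hm6,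
    lintegral_lintegral_swap hm5.aemeasurable]
  congr 2
  have e4 : ∀ x, ∫⁻ y, W.indicator 1 x * p (y - x) = W.indicator 1 x := by
    intro x
    rw [lintegral_const_mul' _ _ (hW1 _), lintegral_sub_right_eq_self p x, hp1, mul_one]
  simp_rw [e4]
  rw [lintegral_indicator_one hW]

end FDNetwork

/-! ### Polar coordinates and the laws of the marks -/

namespace FDNetwork

open Filter Topology

/-- The vector with polar coordinates `r` and `φ`. -/
noncomputable def polarVec (r φ : ℝ) : Plane := !₂[r * Real.cos φ, r * Real.sin φ]

lemma measurable_polarVec : Measurable fun q : ℝ × ℝ => polarVec q.1 q.2 := by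
  refine (WithLp.measurable_toLp 2 (Fin 2 → ℝ)).comp (measurable_pi_iff.2 fun i => ?_)
  fin_cases i
  · simpa using by fun_prop
  · simpa using by fun_prop

lemma norm_polarVec_add_sq (v θ r φ : ℝ) :
    ‖polarVec v θ + polarVec r φ‖ ^ 2 = v ^ 2 + r ^ 2 + 2 * v * r * Real.cos (φ - θ) := by
  rw [EuclideanSpace.norm_sq_eq]
  simp only [polarVec, PiLp.add_apply, Fin.sum_univ_two, Real.norm_eq_abs, sq_abs,
    Real.cos_sub]
  simp only [Matrix.cons_val_zero, Matrix.cons_val_one]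
  linear_combination v ^ 2 * Real.sin_sq_add_cos_sq θ + r ^ 2 * Real.sin_sq_add_cos_sq φ

lemma norm_polarVec {v : ℝ} (hv : 0 ≤ v) (θ : ℝ) : ‖polarVec v θ‖ = v := by
  have h := norm_polarVec_add_sq v θ 0 0
  have h0 : polarVec 0 0 = 0 := by ext i; fin_cases i <;> simp [polarVec]
  rw [h0, add_zero] at h
  exact (sq_eq_sq₀ (norm_nonneg _) hv).1 (by linarith)

lemma polarVec_add_two_pi (v θ : ℝ) : polarVec v (θ + 2 * Real.pi) = polarVec v θ := by
  simp [polarVec]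

lemma setLIntegral_Ioc_periodic {u : ℝ → ℝ≥0∞} (hu : Function.Periodic u (2 * Real.pi)) (a b : ℝ) :
    ∫⁻ θ in Set.Ioc a (a + 2 * Real.pi), u θ = ∫⁻ θ in Set.Ioc b (b + 2 * Real.pi), u θ := by
  refine (isAddFundamentalDomain_Ioc Real.two_pi_pos a).setLIntegral_eq
    (isAddFundamentalDomain_Ioc Real.two_pi_pos b) _ ?_
  rintro ⟨g, hg⟩ x
  obtain ⟨n, rfl⟩ := AddSubgroup.mem_zmultiples_iff.1 hg
  rw [AddSubgroup.vadd_def, vadd_eq_add, add_comm]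
  exact hu.zsmul n x

lemma setLIntegral_Ioc_sub_right {u : ℝ → ℝ≥0∞} (hu : Function.Periodic u (2 * Real.pi)) (c : ℝ) :
    ∫⁻ θ in Set.Ioc 0 (2 * Real.pi), u (θ - c) = ∫⁻ θ in Set.Ioc 0 (2 * Real.pi), u θ := by
  have h := (measurePreserving_sub_right volume c).setLIntegral_comp_preimage_emb
    (measurableEmbedding_subRight c) u (Set.Ioc (0 - c) (0 - c + 2 * Real.pi))
  rw [Set.preimage_sub_const_Ioc, setLIntegral_Ioc_periodic hu (0 - c) 0] at h
  simpa using h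

lemma lintegral_plane_polar {f : Plane → ℝ≥0∞} (hf : Measurable f) :
    ∫⁻ z, f z = ∫⁻ v in Set.Ioi (0 : ℝ), ENNReal.ofReal v *
      ∫⁻ θ in Set.Ioc 0 (2 * Real.pi), f (polarVec v θ) := by
  have hp := (volume_preserving_finTwoArrow ℝ).symm
  have h1 : ∫⁻ z, f z = ∫⁻ q : ℝ × ℝ, f !₂[q.1, q.2] := by
    have hfm : Measurable fun x : Fin 2 → ℝ => f (WithLp.toLp 2 x) :=
      hf.comp (WithLp.measurable_toLp 2 _)
    rw [← (PiLp.volume_preserving_toLp (Fin 2)).lintegral_comp hf, ← hp.lintegral_comp hfm]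
    refine lintegral_congr fun q => ?_
    rfl
  have hpm := measurable_polarVec
  rw [h1, ← lintegral_comp_polarCoord_symm, polarCoord_target, Measure.volume_eq_prod,
    setLIntegral_prod]
  · refine setLIntegral_congr_fun measurableSet_Ioi fun v _ => ?_
    simp only [smul_eq_mul]
    rw [lintegral_const_mul' _ _ (by simp), setLIntegral_congr Ioo_ae_eq_Ioc]
    congr 1
    -- The polar chart takes angles in `(-π, π)`; periodicity moves the window to `(0, 2π]`.
    have := setLIntegral_Ioc_periodic (u := fun θ => f (polarVec v θ))
      (fun θ => by simp only [polarVec_add_two_pi]) (-Real.pi) 0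
    rw [zero_add, show -Real.pi + 2 * Real.pi = Real.pi by ring] at this
    exact this
  · refine Measurable.aemeasurable (Measurable.mul (by fun_prop) ?_)
    exact hf.comp hpm

instance : IsProbabilityMeasure angleMeasure := by
  refine ProbabilityTheory.cond_isProbabilityMeasure_of_finite ?_ ?_ <;> simp [Real.pi_pos, ENNReal.mul_eq_top]

lemma lintegral_angleMeasure (u : ℝ → ℝ≥0∞) :
    ∫⁻ φ, u φ ∂angleMeasure
      = ENNReal.ofReal (1 / (2 * Real.pi)) * ∫⁻ φ in Set.Ioc 0 (2 * Real.pi), u φ := by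
  rw [angleMeasure, ProbabilityTheory.cond, lintegral_smul_measure, Real.volume_Ico, sub_zero,
    ← ENNReal.ofReal_inv_of_pos Real.two_pi_pos, one_div, smul_eq_mul,
    setLIntegral_congr Ico_ae_eq_Ioc]

/-- In polar coordinates a null set has null angular slices for almost every radius `r > 0`, and the
link distance has a density that vanishes for `r ≤ 0`. -/
lemma map_polarVec_absolutelyContinuous (lam : ℝ) {ν : Measure (ℝ × ℝ)} [SFinite ν]
    (hν : ν.snd = linkDistanceMeasure lam) :
    (ν.prod angleMeasure).map (fun q => polarVec q.1.2 q.2) ≪ volume := by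
  have hm : Measurable fun q : (ℝ × ℝ) × ℝ => polarVec q.1.2 q.2 :=
    measurable_polarVec.comp (g := fun p : ℝ × ℝ => polarVec p.1 p.2)
      (f := fun q : (ℝ × ℝ) × ℝ => (q.1.2, q.2)) (by fun_prop)
  refine Measure.AbsolutelyContinuous.mk fun N hN hN0 => ?_
  have hNm : Measurable (N.indicator (1 : Plane → ℝ≥0∞)) := measurable_one.indicator hN
  rw [← lintegral_indicator_one hN, lintegral_map hNm hm, lintegral_prod _ (by exact (hNm.comp hm).aemeasurable)]
  have hin : Measurable fun r => ∫⁻ φ, N.indicator 1 (polarVec r φ) ∂angleMeasure :=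
    (hNm.comp measurable_polarVec).lintegral_prod_right'
  have h1 : ∫⁻ q, (∫⁻ φ, N.indicator 1 (polarVec q.2 φ) ∂angleMeasure) ∂ν
      = ∫⁻ r, (∫⁻ φ, N.indicator 1 (polarVec r φ) ∂angleMeasure) ∂(linkDistanceMeasure lam) := by
    rw [← hν, Measure.snd, lintegral_map hin measurable_snd]
  refine h1.trans ?_
  rw [← lintegral_indicator_one hN, lintegral_plane_polar hNm,
    lintegral_eq_zero_iff (by
      refine Measurable.mul (by fun_prop) ?_
      exact (hNm.comp measurable_polarVec).lintegral_prod_right')] at hN0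
  have hN1 := (ae_restrict_iff' measurableSet_Ioi).1 hN0
  have hpos : Measurable fun r : ℝ => ENNReal.ofReal
      (if 0 ≤ r then 2 * Real.pi * lam * r * Real.exp (-lam * Real.pi * r ^ 2) else 0) := by
    refine ENNReal.measurable_ofReal.comp (Measurable.ite measurableSet_Ici ?_ measurable_const)
    fun_prop
  rw [linkDistanceMeasure, lintegral_withDensity_eq_lintegral_mul _ hpos hin,
    lintegral_eq_zero_iff (hpos.mul hin)]
  filter_upwards [hN1] with r hr
  rw [Pi.mul_apply, Pi.zero_apply, mul_eq_zero]
  rcases lt_or_ge 0 r with h | h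
  · right
    have := hr h
    simp only [Pi.zero_apply, mul_eq_zero, ENNReal.ofReal_eq_zero, not_le.2 h, false_or] at this
    rw [lintegral_angleMeasure, this, mul_zero]
  · left
    rcases h.lt_or_eq with h | h
    · simp [not_le.2 h]
    · simp [h]

lemma ae_nonneg_expMeasure : ∀ᵐ x ∂(expMeasure 1), 0 ≤ x := by
  rw [ae_iff]
  simp only [not_le]
  have : {x : ℝ | x < 0} = Set.Iio 0 := rfl
  rw [this, expMeasure, gammaMeasure, withDensity_apply _ measurableSet_Iio]
  exact lintegral_exponentialPDF_of_nonpos le_rfl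

/-- The integrand times the density is `1 / (1 + t)` times the exponential density of rate `1 + t`.
-/
lemma lintegral_expNeg_expMeasure {t : ℝ} (ht : 0 ≤ t) :
    ∫⁻ x, expNeg (ENNReal.ofReal (t * x)) ∂(expMeasure 1) = ENNReal.ofReal (1 / (1 + t)) := by
  have hm : Measurable (exponentialPDF 1) := (measurable_exponentialPDFReal 1).ennreal_ofReal
  have ht1 : 0 < 1 + t := by linarith
  have hdef : expMeasure 1 = volume.withDensity (exponentialPDF 1) := rfl
  rw [hdef, lintegral_withDensity_eq_lintegral_mul _ hm (by fun_prop)]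
  have : ∀ x, (exponentialPDF 1 * fun x => expNeg (ENNReal.ofReal (t * x))) x
      = ENNReal.ofReal (1 / (1 + t)) * exponentialPDF (1 + t) x := by
    intro x
    rw [Pi.mul_apply]
    rcases lt_or_ge x 0 with hx | hx
    · rw [exponentialPDF_of_neg hx, exponentialPDF_of_neg hx]; simp
    · rw [exponentialPDF_of_nonneg hx, exponentialPDF_of_nonneg hx, expNeg_ofReal (by positivity),
        ← ENNReal.ofReal_mul (by positivity), ← ENNReal.ofReal_mul (by positivity)]
      congr 1
      rw [← mul_assoc, one_div_mul_cancel ht1.ne', one_mul, one_mul, one_mul, ← Real.exp_add]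
      congr 1
      ring
  simp_rw [this]
  rw [lintegral_const_mul' _ _ ENNReal.ofReal_ne_top,
    lintegral_exponentialPDF_eq_one ht1, mul_one]

end FDNetwork

/-! ### Path loss, fading average and finiteness of the exponent -/

namespace FDNetwork

open Filter Topology

/-- The bound is integrable over the plane when `α > 2`. The constant `2 ^ α` comes from `1 + r ≤ 2`
for `r < 1` and `1 + r ≤ 2 r` for `r ≥ 1`. -/
lemma min_one_mul_rpow_le {α c r : ℝ} (hα : 0 < α) (hr : 0 ≤ r) :
    min 1 (c * r ^ (-α)) ≤ max 1 c * 2 ^ α * (1 + r) ^ (-α) := by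
  have h2 : (0 : ℝ) < 2 ^ α := by positivity
  have hm : (1 : ℝ) ≤ max 1 c := le_max_left _ _
  rcases lt_or_ge r 1 with h | h
  · refine (min_le_left _ _).trans ?_
    have h1 : (2 : ℝ) ^ (-α) ≤ (1 + r) ^ (-α) :=
      Real.rpow_le_rpow_of_nonpos (by linarith) (by linarith) (by linarith)
    calc (1 : ℝ) = 1 * 2 ^ α * 2 ^ (-α) := by rw [Real.rpow_neg (by norm_num)]; field_simp
      _ ≤ max 1 c * 2 ^ α * (1 + r) ^ (-α) := by gcongr
  · refine (min_le_right _ _).trans ?_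
    have hr0 : 0 < r := by linarith
    have h1 : (2 * r) ^ (-α) ≤ (1 + r) ^ (-α) :=
      Real.rpow_le_rpow_of_nonpos (by linarith) (by linarith) (by linarith)
    calc c * r ^ (-α) ≤ max 1 c * r ^ (-α) := by gcongr; exact le_max_right _ _
      _ = max 1 c * 2 ^ α * (2 * r) ^ (-α) := by
        rw [Real.mul_rpow (by norm_num) hr, Real.rpow_neg (x := 2) (by norm_num)]
        field_simp
      _ ≤ max 1 c * 2 ^ α * (1 + r) ^ (-α) := by gcongr

/-- The integral over the plane of the path loss, truncated at one. -/
noncomputable def truncatedPathLoss (α c : ℝ) : ℝ≥0∞ :=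
  ∫⁻ z : Plane, ENNReal.ofReal (min 1 (c * ‖z‖ ^ (-α)))

lemma truncatedPathLoss_ne_top {α : ℝ} (hα : 2 < α) (c : ℝ) : truncatedPathLoss α c ≠ ∞ := by
  have hi : Integrable (fun z : Plane => max 1 c * 2 ^ α * (1 + ‖z‖) ^ (-α)) :=
    (integrable_one_add_norm (by simpa using hα)).const_mul _
  refine ((lintegral_mono fun z => ENNReal.ofReal_le_ofReal
    (min_one_mul_rpow_le (by linarith) (norm_nonneg z))).trans_lt ?_).ne
  exact hi.lintegral_lt_top

lemma truncatedPathLoss_mono {α c c' : ℝ} (h : c ≤ c') :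
    truncatedPathLoss α c ≤ truncatedPathLoss α c' :=
  lintegral_mono fun z => ENNReal.ofReal_le_ofReal
    (min_le_min_left _ (mul_le_mul_of_nonneg_right h (by positivity)))

lemma tendsto_truncatedPathLoss {α c : ℝ} (hα : 2 < α) (hc : 0 ≤ c) :
    Tendsto (fun n : ℕ => truncatedPathLoss α (1 / ((n : ℝ) + 1) * c)) atTop (𝓝 0) := by
  have h0 : (0 : ℝ≥0∞) = ∫⁻ z : Plane, ENNReal.ofReal (min 1 (0 * c * ‖z‖ ^ (-α))) := by simp
  rw [h0]
  refine tendsto_lintegral_of_dominated_convergence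
    (fun z => ENNReal.ofReal (min 1 (c * ‖z‖ ^ (-α)))) (fun n => by fun_prop)
    (fun n => ae_of_all _ fun z => ?_) (truncatedPathLoss_ne_top hα c) (ae_of_all _ fun z => ?_)
  · refine ENNReal.ofReal_le_ofReal (min_le_min_left _ (mul_le_mul_of_nonneg_right ?_ (by positivity)))
    refine mul_le_of_le_one_left hc ?_
    rw [div_le_one (by positivity)]
    linarith [(Nat.cast_nonneg n : (0 : ℝ) ≤ n)]
  · refine (ENNReal.continuous_ofReal.tendsto _).comp (tendsto_const_nhds.min ?_)
    exact (tendsto_one_div_add_atTop_nhds_zero_nat.mul_const c).mul_const _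

/-- The power received at the origin from a BS at `z` with the given mark and from its UE. -/
noncomputable def pairPower (α Pu : ℝ) (z : Plane) (m : (ℝ × ℝ) × ℝ × ℝ × ℝ) : ℝ :=
  m.1.1 * m.2.2.1 * ‖z‖ ^ (-α) + Pu * m.2.2.2 * ‖z + polarVec m.1.2 m.2.1‖ ^ (-α)

/-- The law of a mark. -/
noncomputable def markLaw (ν : Measure (ℝ × ℝ)) : Measure ((ℝ × ℝ) × ℝ × ℝ × ℝ) :=
  ν.prod (angleMeasure.prod ((expMeasure 1).prod (expMeasure 1)))

/-- The conditional Laplace transform, given power and displacement, of the power received at the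
origin from a BS at `z` and its UE at `z + w`. -/
noncomputable def pairLaplace (α Pu s P : ℝ) (z w : Plane) : ℝ :=
  1 / (1 + s * P * ‖z‖ ^ (-α)) * (1 / (1 + s * Pu * ‖z + w‖ ^ (-α)))

instance : IsProbabilityMeasure (expMeasure 1) := isProbabilityMeasure_expMeasure one_pos

instance (ν : Measure (ℝ × ℝ)) [IsProbabilityMeasure ν] : IsProbabilityMeasure (markLaw ν) :=
  inferInstanceAs (IsProbabilityMeasure (ν.prod _))

lemma measurable_pairPower (α Pu : ℝ) : Measurable (Function.uncurry (pairPower α Pu)) := by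
  have : Measurable fun q : Plane × ((ℝ × ℝ) × ℝ × ℝ × ℝ) => polarVec q.2.1.2 q.2.2.1 :=
    measurable_polarVec.comp (g := fun p : ℝ × ℝ => polarVec p.1 p.2)
      (f := fun q : Plane × ((ℝ × ℝ) × ℝ × ℝ × ℝ) => (q.2.1.2, q.2.2.1)) (by fun_prop)
  unfold Function.uncurry pairPower
  fun_prop

lemma one_div_mul_one_div_mem {a b : ℝ} (ha : 0 ≤ a) (hb : 0 ≤ b) :
    1 / (1 + a) * (1 / (1 + b)) ∈ Set.Icc (0 : ℝ) 1 := by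
  refine ⟨by positivity, mul_le_one₀ ?_ (by positivity) ?_⟩ <;>
  · rw [div_le_one (by positivity)]; linarith

/-- For `x, y` in `[0, 1]` one has `1 - x y ≤ (1 - x) + (1 - y)`, and `1 - 1 / (1 + a) = a / (1 +
a)`. This separates the BS link from the UE link. -/
lemma one_sub_one_div_mul_le {a b : ℝ} (ha : 0 ≤ a) (hb : 0 ≤ b) :
    1 - 1 / (1 + a) * (1 / (1 + b)) ≤ min 1 a + min 1 b := by
  have key : ∀ x : ℝ, 0 ≤ x → 1 - 1 / (1 + x) ≤ min 1 x := by
    intro x hx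
    refine le_min (by simp; positivity) ?_
    rw [sub_le_iff_le_add, ← sub_le_iff_le_add', le_div_iff₀ (by positivity)]
    nlinarith
  have h1 : 1 / (1 + a) ≤ 1 := by rw [div_le_one (by positivity)]; linarith
  have h2 : 1 / (1 + b) ≤ 1 := by rw [div_le_one (by positivity)]; linarith
  have h3 := key a ha
  have h4 := key b hb
  nlinarith

lemma pairLaplace_mem {α Pu s P : ℝ} (hPu : 0 ≤ Pu) (hs : 0 ≤ s) (hP : 0 ≤ P) (z w : Plane) :
    pairLaplace α Pu s P z w ∈ Set.Icc (0 : ℝ) 1 :=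
  one_div_mul_one_div_mem (by positivity) (by positivity)

lemma measurable_pairLaplace (α Pu s : ℝ) :
    Measurable fun q : (Plane × ℝ × ℝ) × ℝ =>
      pairLaplace α Pu s q.1.2.1 q.1.1 (polarVec q.1.2.2 q.2) := by
  have : Measurable fun q : (Plane × ℝ × ℝ) × ℝ => polarVec q.1.2.2 q.2 :=
    measurable_polarVec.comp (g := fun p : ℝ × ℝ => polarVec p.1 p.2)
      (f := fun q : (Plane × ℝ × ℝ) × ℝ => (q.1.2.2, q.2)) (by fun_prop)
  unfold pairLaplace
  fun_prop

variable {α Pu s Pmax : ℝ} {ν : Measure (ℝ × ℝ)}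

lemma lintegral_fading {a b : ℝ} (ha : 0 ≤ a) (hb : 0 ≤ b) :
    ∫⁻ h, expNeg (ENNReal.ofReal (a * h.1 + b * h.2)) ∂((expMeasure 1).prod (expMeasure 1))
      = ENNReal.ofReal (1 / (1 + a) * (1 / (1 + b))) := by
  rw [lintegral_prod _ (by fun_prop)]
  have : ∀ᵐ x ∂(expMeasure 1), ∫⁻ y, expNeg (ENNReal.ofReal (a * x + b * y)) ∂(expMeasure 1)
      = expNeg (ENNReal.ofReal (a * x)) * ENNReal.ofReal (1 / (1 + b)) := by
    filter_upwards [ae_nonneg_expMeasure] with x hx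
    rw [← lintegral_expNeg_expMeasure hb, ← lintegral_const_mul' _ _ (expNeg_ne_top _)]
    refine lintegral_congr_ae ?_
    filter_upwards [ae_nonneg_expMeasure] with y hy
    rw [ENNReal.ofReal_add (by positivity) (by positivity), expNeg_add]
  rw [lintegral_congr_ae this, lintegral_mul_const' _ _ ENNReal.ofReal_ne_top,
    lintegral_expNeg_expMeasure ha, ← ENNReal.ofReal_mul (by positivity)]

lemma lintegral_expNeg_pairPower [IsProbabilityMeasure ν] (hPu : 0 ≤ Pu) (hs : 0 ≤ s)
    (hν : ∀ᵐ q ∂ν, 0 ≤ q.1) (z : Plane) :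
    ∫⁻ m, expNeg (ENNReal.ofReal s * ENNReal.ofReal (pairPower α Pu z m)) ∂(markLaw ν)
      = ∫⁻ q, (∫⁻ φ, ENNReal.ofReal (pairLaplace α Pu s q.1 z (polarVec q.2 φ)) ∂angleMeasure)
        ∂ν := by
  have hm : Measurable fun m => expNeg (ENNReal.ofReal s * ENNReal.ofReal (pairPower α Pu z m)) := by
    have : Measurable (pairPower α Pu z) :=
      (measurable_pairPower α Pu).comp (measurable_const.prodMk measurable_id)
    fun_prop
  rw [markLaw, lintegral_prod _ hm.aemeasurable]
  refine lintegral_congr_ae ?_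
  filter_upwards [hν] with q hq
  have hm' : Measurable fun y : ℝ × ℝ × ℝ =>
      expNeg (ENNReal.ofReal s * ENNReal.ofReal (pairPower α Pu z (q, y))) :=
    hm.comp (measurable_const.prodMk measurable_id)
  rw [lintegral_prod _ hm'.aemeasurable]
  refine lintegral_congr fun φ => ?_
  rw [pairLaplace, ← lintegral_fading (by positivity) (by positivity)]
  refine lintegral_congr fun h => ?_
  rw [← ENNReal.ofReal_mul hs, pairPower]
  congr 2
  ring

lemma one_sub_lintegral_expNeg_pairPower [IsProbabilityMeasure ν] (hPu : 0 ≤ Pu) (hs : 0 ≤ s)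
    (hν : ∀ᵐ q ∂ν, 0 ≤ q.1) (z : Plane) :
    1 - ∫⁻ m, expNeg (ENNReal.ofReal s * ENNReal.ofReal (pairPower α Pu z m)) ∂(markLaw ν)
      = ∫⁻ q, (∫⁻ φ, ENNReal.ofReal (1 - pairLaplace α Pu s q.1 z (polarVec q.2 φ)) ∂angleMeasure)
        ∂ν := by
  rw [lintegral_expNeg_pairPower hPu hs hν]
  have hm : Measurable fun q : (ℝ × ℝ) × ℝ => pairLaplace α Pu s q.1.1 z (polarVec q.1.2 q.2) :=
    (measurable_pairLaplace α Pu s).comp (g := fun q : (Plane × ℝ × ℝ) × ℝ =>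
      pairLaplace α Pu s q.1.2.1 q.1.1 (polarVec q.1.2.2 q.2))
      (f := fun q : (ℝ × ℝ) × ℝ => ((z, q.1), q.2)) (by fun_prop)
  have hm1 := hm.ennreal_ofReal.lintegral_prod_right' (ν := angleMeasure)
  refine ENNReal.sub_eq_of_eq_add_rev ?_ ?_
  · refine ((lintegral_mono_ae (g := fun _ => 1) ?_).trans_lt (by simp)).ne
    filter_upwards [hν] with q hq
    refine (lintegral_mono (g := fun _ => 1) fun φ => ?_).trans (by simp)
    exact ENNReal.ofReal_le_one.2 (pairLaplace_mem hPu hs hq z _).2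
  · rw [← lintegral_add_left hm1]
    have : ∀ᵐ q ∂ν, (1 : ℝ≥0∞) =
        ∫⁻ φ, ENNReal.ofReal (pairLaplace α Pu s q.1 z (polarVec q.2 φ)) ∂angleMeasure
        + ∫⁻ φ, ENNReal.ofReal (1 - pairLaplace α Pu s q.1 z (polarVec q.2 φ)) ∂angleMeasure := by
      filter_upwards [hν] with q hq
      have hmq : Measurable fun φ => pairLaplace α Pu s q.1 z (polarVec q.2 φ) :=
        hm.comp (measurable_const.prodMk measurable_id)
      rw [← lintegral_add_left hmq.ennreal_ofReal]
      have : ∀ φ, ENNReal.ofReal (pairLaplace α Pu s q.1 z (polarVec q.2 φ))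
          + ENNReal.ofReal (1 - pairLaplace α Pu s q.1 z (polarVec q.2 φ)) = 1 := by
        intro φ
        have := pairLaplace_mem (α := α) hPu hs hq z (polarVec q.2 φ)
        rw [← ENNReal.ofReal_add this.1 (sub_nonneg.2 this.2)]
        simp
      simp [this]
    rw [← lintegral_congr_ae this]
    simp

/-- The integral over the plane of one minus the Laplace transform of the power received from a
BS-UE pair. -/
noncomputable def exponent (α Pu : ℝ) (ν : Measure (ℝ × ℝ)) (s : ℝ) : ℝ≥0∞ :=
  ∫⁻ z, (1 - ∫⁻ m, expNeg (ENNReal.ofReal s * ENNReal.ofReal (pairPower α Pu z m)) ∂(markLaw ν))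

/-- Tonelli makes the integral over the plane innermost, where translations and polar coordinates
can be used with the mark fixed. -/
lemma exponent_eq [IsProbabilityMeasure ν] (hPu : 0 ≤ Pu) (hs : 0 ≤ s)
    (hν : ∀ᵐ q ∂ν, 0 ≤ q.1) :
    exponent α Pu ν s = ∫⁻ q, (∫⁻ φ, (∫⁻ z,
      ENNReal.ofReal (1 - pairLaplace α Pu s q.1 z (polarVec q.2 φ))) ∂angleMeasure) ∂ν := by
  have hm : Measurable fun q : (Plane × ℝ × ℝ) × ℝ =>
      ENNReal.ofReal (1 - pairLaplace α Pu s q.1.2.1 q.1.1 (polarVec q.1.2.2 q.2)) :=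
    ((measurable_pairLaplace α Pu s).const_sub 1).ennreal_ofReal
  rw [exponent]
  simp_rw [one_sub_lintegral_expNeg_pairPower hPu hs hν]
  rw [lintegral_lintegral_swap (by exact hm.lintegral_prod_right'.aemeasurable)]
  refine lintegral_congr fun q => ?_
  rw [lintegral_lintegral_swap]
  exact (hm.comp (g := fun q : (Plane × ℝ × ℝ) × ℝ =>
      ENNReal.ofReal (1 - pairLaplace α Pu s q.1.2.1 q.1.1 (polarVec q.1.2.2 q.2)))
      (f := fun p : Plane × ℝ => ((p.1, q), p.2)) (by fun_prop)).aemeasurable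

/-- A translation of `z` absorbs the displacement of the UE, so the bound does not depend on the
link distance, however it is coupled to the power. -/
lemma exponent_le [IsProbabilityMeasure ν] (hPu : 0 ≤ Pu) (hs : 0 ≤ s)
    (hν : ∀ᵐ q ∂ν, q.1 ∈ Set.Icc 0 Pmax) :
    exponent α Pu ν s ≤ truncatedPathLoss α (s * Pmax) + truncatedPathLoss α (s * Pu) := by
  rw [exponent_eq hPu hs (hν.mono fun q hq => hq.1)]
  refine (lintegral_mono_ae (g := fun _ => truncatedPathLoss α (s * Pmax)
    + truncatedPathLoss α (s * Pu)) ?_).trans (by simp)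
  filter_upwards [hν] with q hq
  refine (lintegral_mono (g := fun _ => truncatedPathLoss α (s * Pmax)
    + truncatedPathLoss α (s * Pu)) fun φ => ?_).trans (by simp)
  have hq0 := hq.1
  have htr : truncatedPathLoss α (s * Pu) = ∫⁻ z : Plane,
      ENNReal.ofReal (min 1 (s * Pu * ‖z + polarVec q.2 φ‖ ^ (-α))) :=
    (lintegral_add_right_eq_self (fun z : Plane => ENNReal.ofReal (min 1 (s * Pu * ‖z‖ ^ (-α)))) _).symm
  have hmono : truncatedPathLoss α (s * q.1) ≤ truncatedPathLoss α (s * Pmax) :=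
    truncatedPathLoss_mono (mul_le_mul_of_nonneg_left hq.2 hs)
  refine le_trans ?_ (add_le_add_left hmono _)
  rw [htr, truncatedPathLoss, ← lintegral_add_left (by fun_prop)]
  refine lintegral_mono fun z => ?_
  rw [← ENNReal.ofReal_add (by positivity) (by positivity)]
  exact ENNReal.ofReal_le_ofReal (one_sub_one_div_mul_le (by positivity) (by positivity))

lemma exponent_ne_top [IsProbabilityMeasure ν] (hα : 2 < α) (hPu : 0 ≤ Pu) (hs : 0 ≤ s)
    (hν : ∀ᵐ q ∂ν, q.1 ∈ Set.Icc 0 Pmax) : exponent α Pu ν s ≠ ∞ :=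
  ne_top_of_le_ne_top (ENNReal.add_ne_top.2 ⟨truncatedPathLoss_ne_top hα _,
    truncatedPathLoss_ne_top hα _⟩) (exponent_le hPu hs hν)

lemma tendsto_exponent [IsProbabilityMeasure ν] (hα : 2 < α) (hPu : 0 ≤ Pu)
    (hν : ∀ᵐ q ∂ν, q.1 ∈ Set.Icc 0 Pmax) :
    Tendsto (fun n : ℕ => exponent α Pu ν (1 / ((n : ℝ) + 1))) atTop (𝓝 0) := by
  have hmax : 0 ≤ Pmax := by
    obtain ⟨q, hq⟩ := hν.exists
    exact hq.1.trans hq.2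
  have h := (tendsto_truncatedPathLoss hα hmax).add (tendsto_truncatedPathLoss hα hPu)
  rw [add_zero] at h
  exact tendsto_of_tendsto_of_tendsto_of_le_of_le tendsto_const_nhds h (fun _ => zero_le)
    (fun n => exponent_le hPu (by positivity) hν)

end FDNetwork

/-! ### The exponent as an iterated real integral -/

namespace FDNetwork

open Filter Topology

/-- The kernel `pairLaplace` in polar coordinates centred at the observed point, for power and link
distance `q`. -/
noncomputable def polarKernel (α Pu s : ℝ) (q : ℝ × ℝ) (v φ : ℝ) : ℝ :=
  1 / (1 + s * q.1 * v ^ (-α)) *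
    (1 / (1 + s * Pu * (v ^ 2 + q.2 ^ 2 + 2 * v * q.2 * Real.cos φ) ^ (-α / 2)))

/-- The radial density of `exponent`, for power and link distance `q`. -/
noncomputable def radialDefect (α Pu s : ℝ) (q : ℝ × ℝ) (v : ℝ) : ℝ :=
  (1 - 1 / (2 * Real.pi) * ∫ φ in (0 : ℝ)..(2 * Real.pi), polarKernel α Pu s q v φ) * v

variable {α Pu s Pmax : ℝ} {ν : Measure (ℝ × ℝ)}

lemma measurable_polarKernel (α Pu s : ℝ) :
    Measurable fun p : ((ℝ × ℝ) × ℝ) × ℝ => polarKernel α Pu s p.1.1 p.1.2 p.2 := by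
  unfold polarKernel
  fun_prop

lemma polarKernel_mem (hPu : 0 ≤ Pu) (hs : 0 ≤ s) {q : ℝ × ℝ} (hq : 0 ≤ q.1) {v : ℝ} (hv : 0 ≤ v)
    (φ : ℝ) : polarKernel α Pu s q v φ ∈ Set.Icc (0 : ℝ) 1 := by
  have h : 0 ≤ v ^ 2 + q.2 ^ 2 + 2 * v * q.2 * Real.cos φ := by
    nlinarith [sq_nonneg (v * Real.cos φ + q.2), Real.sin_sq_add_cos_sq φ,
      mul_nonneg (sq_nonneg v) (sq_nonneg (Real.sin φ))]
  exact one_div_mul_one_div_mem (by positivity) (by positivity)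

lemma pairLaplace_polarVec {q : ℝ × ℝ} {v : ℝ} (hv : 0 ≤ v) (θ φ : ℝ) :
    pairLaplace α Pu s q.1 (polarVec v θ) (polarVec q.2 φ) = polarKernel α Pu s q v (θ - φ) := by
  have h := norm_polarVec_add_sq v θ q.2 φ
  rw [pairLaplace, polarKernel, norm_polarVec hv, ← Real.cos_neg, neg_sub, ← h,
    ← Real.rpow_natCast_mul (norm_nonneg _)]
  congr 5
  push_cast
  ring

/-- By rotation invariance the kernel depends on `θ - φ` only, so after integrating over `θ` the
uniform direction `φ` of the UE averages out. -/
lemma exponent_eq_polar [IsProbabilityMeasure ν] (hPu : 0 ≤ Pu) (hs : 0 ≤ s)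
    (hν : ∀ᵐ q ∂ν, 0 ≤ q.1) :
    exponent α Pu ν s = ∫⁻ q, (∫⁻ v in Set.Ioi (0 : ℝ), ENNReal.ofReal v *
      ∫⁻ θ in Set.Ioc 0 (2 * Real.pi), ENNReal.ofReal (1 - polarKernel α Pu s q v θ)) ∂ν := by
  rw [exponent_eq hPu hs hν]
  refine lintegral_congr fun q => ?_
  have : ∀ φ, ∫⁻ z, ENNReal.ofReal (1 - pairLaplace α Pu s q.1 z (polarVec q.2 φ))
      = ∫⁻ v in Set.Ioi (0 : ℝ), ENNReal.ofReal v *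
      ∫⁻ θ in Set.Ioc 0 (2 * Real.pi), ENNReal.ofReal (1 - polarKernel α Pu s q v θ) := by
    intro φ
    have hm : Measurable fun z => ENNReal.ofReal (1 - pairLaplace α Pu s q.1 z (polarVec q.2 φ)) := by
      unfold pairLaplace
      fun_prop
    rw [lintegral_plane_polar hm]
    refine setLIntegral_congr_fun measurableSet_Ioi fun v hv => ?_
    have hv' : (0 : ℝ) ≤ v := le_of_lt hv
    simp_rw [pairLaplace_polarVec hv']
    rw [setLIntegral_Ioc_sub_right
      (u := fun θ => ENNReal.ofReal (1 - polarKernel α Pu s q v θ)) (fun θ => by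
        simp only [polarKernel, Real.cos_add_two_pi])]
  simp [this]

lemma integrable_polarKernel {E : Type*} [MeasurableSpace E] {m : Measure E} [IsFiniteMeasure m]
    {q : E → ℝ × ℝ} {v φ : E → ℝ} (hqm : Measurable q) (hvm : Measurable v) (hφm : Measurable φ)
    (hPu : 0 ≤ Pu) (hs : 0 ≤ s) (hq : ∀ x, 0 ≤ (q x).1) (hv : ∀ x, 0 ≤ v x) :
    Integrable (fun x => polarKernel α Pu s (q x) (v x) (φ x)) m := by
  refine Integrable.of_bound (C := 1) ?_ (ae_of_all _ fun x => ?_)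
  · exact ((measurable_polarKernel α Pu s).comp
      (f := fun x => ((q x, v x), φ x)) (by fun_prop)).aestronglyMeasurable
  · have := polarKernel_mem (α := α) hPu hs (hq x) (hv x) (φ x)
    rw [Real.norm_eq_abs, abs_le]
    exact ⟨by linarith [this.1], this.2⟩

lemma measurable_radialDefect (α Pu s : ℝ) :
    Measurable fun p : (ℝ × ℝ) × ℝ => radialDefect α Pu s p.1 p.2 := by
  unfold radialDefect
  simp_rw [intervalIntegral.integral_of_le Real.two_pi_pos.le]
  have := (measurable_polarKernel α Pu s).stronglyMeasurable.integral_prod_right'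
    (ν := volume.restrict (Set.Ioc 0 (2 * Real.pi)))
  have := this.measurable
  fun_prop

/-- The kernel lies in `[0, 1]`, so the defect is nonnegative and the passage from integrals in `[0,
∞]` to real integrals loses nothing. -/
lemma ofReal_radialDefect (hPu : 0 ≤ Pu) (hs : 0 ≤ s) {q : ℝ × ℝ} (hq : 0 ≤ q.1) {v : ℝ}
    (hv : 0 ≤ v) :
    0 ≤ radialDefect α Pu s q v ∧
    ENNReal.ofReal v *
      ∫⁻ θ in Set.Ioc 0 (2 * Real.pi), ENNReal.ofReal (1 - polarKernel α Pu s q v θ)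
      = ENNReal.ofReal (2 * Real.pi * radialDefect α Pu s q v) := by
  have hi : Integrable (fun θ => polarKernel α Pu s q v θ)
      (volume.restrict (Set.Ioc 0 (2 * Real.pi))) :=
    integrable_polarKernel measurable_const measurable_const measurable_id hPu hs
      (fun _ => hq) (fun _ => hv)
  have h0 : ∀ θ, 0 ≤ 1 - polarKernel α Pu s q v θ := fun θ =>
    sub_nonneg.2 (polarKernel_mem hPu hs hq hv θ).2
  have hint : ∫ θ in Set.Ioc 0 (2 * Real.pi), (1 - polarKernel α Pu s q v θ)
      = 2 * Real.pi - ∫ θ in Set.Ioc 0 (2 * Real.pi), polarKernel α Pu s q v θ := by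
    rw [integral_sub (integrable_const _) hi]
    simp [Real.pi_pos.le]
  have heq : v * (2 * Real.pi - ∫ θ in Set.Ioc 0 (2 * Real.pi), polarKernel α Pu s q v θ)
      = 2 * Real.pi * radialDefect α Pu s q v := by
    rw [radialDefect, intervalIntegral.integral_of_le Real.two_pi_pos.le]
    have := Real.pi_ne_zero
    field_simp
  have hnn := mul_nonneg hv (integral_nonneg (μ := volume.restrict (Set.Ioc 0 (2 * Real.pi))) h0)
  rw [hint, heq] at hnn
  refine ⟨nonneg_of_mul_nonneg_right hnn Real.two_pi_pos, ?_⟩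
  rw [← ofReal_integral_eq_lintegral_ofReal (by exact (integrable_const _).sub hi)
    (ae_of_all _ h0), hint,
    ← ENNReal.ofReal_mul hv, heq]

lemma exponent_eq_lintegral_radialDefect [IsProbabilityMeasure ν] (hPu : 0 ≤ Pu) (hs : 0 ≤ s)
    (hν : ∀ᵐ q ∂ν, 0 ≤ q.1) :
    exponent α Pu ν s = ∫⁻ p, ENNReal.ofReal (2 * Real.pi * radialDefect α Pu s p.1 p.2)
      ∂(ν.prod (volume.restrict (Set.Ioi 0))) := by
  have hm := ((measurable_radialDefect α Pu s).const_mul (2 * Real.pi)).ennreal_ofReal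
  rw [exponent_eq_polar hPu hs hν, lintegral_prod _ hm.aemeasurable]
  refine lintegral_congr_ae ?_
  filter_upwards [hν] with q hq
  exact setLIntegral_congr_fun measurableSet_Ioi fun v hv =>
    (ofReal_radialDefect hPu hs hq (le_of_lt hv)).2

lemma ae_radialDefect_nonneg [SFinite ν] (hPu : 0 ≤ Pu) (hs : 0 ≤ s)
    (hν : ∀ᵐ q ∂ν, 0 ≤ q.1) :
    ∀ᵐ p ∂(ν.prod (volume.restrict (Set.Ioi 0))), 0 ≤ radialDefect α Pu s p.1 p.2 := by
  rw [Measure.ae_prod_iff_ae_ae (measurableSet_le measurable_const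
    (measurable_radialDefect α Pu s))]
  filter_upwards [hν] with q hq
  filter_upwards [ae_restrict_mem measurableSet_Ioi] with v hv
  exact (ofReal_radialDefect hPu hs hq (le_of_lt hv)).1

lemma integrable_radialDefect [IsProbabilityMeasure ν] (hα : 2 < α) (hPu : 0 ≤ Pu) (hs : 0 ≤ s)
    (hν : ∀ᵐ q ∂ν, q.1 ∈ Set.Icc 0 Pmax) :
    Integrable (fun p : (ℝ × ℝ) × ℝ => radialDefect α Pu s p.1 p.2)
      (ν.prod (volume.restrict (Set.Ioi 0))) := by
  have hν0 := hν.mono fun q hq => hq.1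
  have h2 : Integrable (fun p : (ℝ × ℝ) × ℝ => 2 * Real.pi * radialDefect α Pu s p.1 p.2)
      (ν.prod (volume.restrict (Set.Ioi 0))) := by
    refine ⟨((measurable_radialDefect α Pu s).const_mul _).aestronglyMeasurable, ?_⟩
    rw [hasFiniteIntegral_iff_ofReal, ← exponent_eq_lintegral_radialDefect hPu hs hν0]
    · exact (exponent_ne_top hα hPu hs hν).lt_top
    · filter_upwards [ae_radialDefect_nonneg hPu hs hν0] with p hp
      exact mul_nonneg Real.two_pi_pos.le hp
  refine (h2.const_mul (2 * Real.pi)⁻¹).congr (ae_of_all _ fun p => ?_)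
  exact inv_mul_cancel_left₀ Real.two_pi_pos.ne' _

lemma exponent_eq_integral [IsProbabilityMeasure ν] (hα : 2 < α) (hPu : 0 ≤ Pu) (hs : 0 ≤ s)
    (hν : ∀ᵐ q ∂ν, q.1 ∈ Set.Icc 0 Pmax) :
    0 ≤ ∫ q, (∫ v in Set.Ioi (0 : ℝ), radialDefect α Pu s q v) ∂ν ∧
    exponent α Pu ν s = ENNReal.ofReal
      (2 * Real.pi * ∫ q, (∫ v in Set.Ioi (0 : ℝ), radialDefect α Pu s q v) ∂ν) := by
  have hν0 := hν.mono fun q hq => hq.1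
  have hi := integrable_radialDefect hα hPu hs hν
  have h0 := ae_radialDefect_nonneg (α := α) hPu hs hν0
  have hint := integral_prod _ hi
  dsimp only at hint
  rw [← hint, exponent_eq_lintegral_radialDefect hPu hs hν0,
    ← ofReal_integral_eq_lintegral_ofReal (hi.const_mul _), integral_const_mul]
  · exact ⟨integral_nonneg_of_ae h0, rfl⟩
  · filter_upwards [h0] with p hp
    exact mul_nonneg Real.two_pi_pos.le hp

lemma integral_linkDistanceMeasure (lam : ℝ) (hlam : 0 ≤ lam) (f : ℝ → ℝ) :
    ∫ r, f r ∂(linkDistanceMeasure lam) = ∫ r in Set.Ioi (0 : ℝ),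
      2 * Real.pi * (lam * r * Real.exp (-Real.pi * lam * r ^ 2)) * f r := by
  have hm : Measurable fun r : ℝ => ENNReal.ofReal
      (if 0 ≤ r then 2 * Real.pi * lam * r * Real.exp (-lam * Real.pi * r ^ 2) else 0) := by
    refine ENNReal.measurable_ofReal.comp (Measurable.ite measurableSet_Ici ?_ measurable_const)
    fun_prop
  rw [linkDistanceMeasure, integral_withDensity_eq_integral_toReal_smul hm
    (ae_of_all _ fun _ => ENNReal.ofReal_lt_top), ← integral_indicator measurableSet_Ioi]
  refine integral_congr_ae (ae_of_all _ fun r => ?_)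
  dsimp only
  rcases lt_trichotomy r 0 with h | h | h
  · simp [not_le.2 h, not_lt.2 h.le]
  · simp [h]
  · have h' : 0 ≤ r := h.le
    rw [Set.indicator_of_mem (Set.mem_Ioi.2 h), if_pos h', ENNReal.toReal_ofReal (by have := Real.pi_pos; positivity),
      smul_eq_mul]
    ring_nf

/-- The factor `2π` in the link density cancels the normalisation `1 / (2π)` of the angle; Fubini
applies since the kernel is bounded and both measures are finite. -/
lemma integral_radialDefect_linkDistance {lam : ℝ} (hlam : 0 ≤ lam)
    [IsProbabilityMeasure (linkDistanceMeasure lam)] (hPu : 0 ≤ Pu)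
    (hs : 0 ≤ s) {p : ℝ} (hp : 0 ≤ p) {v : ℝ} (hv : 0 ≤ v) :
    ∫ r, radialDefect α Pu s (p, r) v ∂(linkDistanceMeasure lam)
      = (1 - ∫ φ in (0 : ℝ)..(2 * Real.pi), ∫ r in Set.Ioi (0 : ℝ),
          1 / (1 + s * p * v ^ (-α)) * (lam * r * Real.exp (-Real.pi * lam * r ^ 2) /
            (1 + s * Pu * (v ^ 2 + r ^ 2 + 2 * v * r * Real.cos φ) ^ (-α / 2)))) * v := by
  have hi : Integrable (fun x : ℝ × ℝ => polarKernel α Pu s (p, x.1) v x.2)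
      ((linkDistanceMeasure lam).prod (volume.restrict (Set.Ioc 0 (2 * Real.pi)))) :=
    integrable_polarKernel (by fun_prop) (by fun_prop) (by fun_prop) hPu hs
      (fun _ => hp) (fun _ => hv)
  have hi' := hi.integral_prod_left
  simp_rw [radialDefect, intervalIntegral.integral_of_le Real.two_pi_pos.le]
  rw [integral_mul_const, integral_sub (integrable_const _) (hi'.const_mul _), integral_const_mul,
    integral_integral_swap hi]
  simp only [integral_const, probReal_univ, smul_eq_mul, mul_one]
  congr 2
  rw [← integral_const_mul]
  refine integral_congr_ae (ae_of_all _ fun φ => ?_)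
  dsimp only
  rw [integral_linkDistanceMeasure lam hlam, ← integral_const_mul]
  refine integral_congr_ae (ae_of_all _ fun r => ?_)
  have := Real.pi_ne_zero
  simp only [polarKernel]
  field_simp

lemma integral_radialDefect_of_indep {lam : ℝ} (hlam : 0 ≤ lam) [IsProbabilityMeasure ν]
    (hα : 2 < α) (hPu : 0 ≤ Pu) (hs : 0 ≤ s) (hν : ∀ᵐ q ∂ν, q.1 ∈ Set.Icc 0 Pmax)
    (hνR : ν.snd = linkDistanceMeasure lam) (hind : ν = ν.fst.prod ν.snd) :
    ∫ q, (∫ v in Set.Ioi (0 : ℝ), radialDefect α Pu s q v) ∂ν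
      = ∫ p, (∫ v in Set.Ioi (0 : ℝ),
        (1 - ∫ φ in (0 : ℝ)..(2 * Real.pi), ∫ r in Set.Ioi (0 : ℝ),
          1 / (1 + s * p * v ^ (-α)) * (lam * r * Real.exp (-Real.pi * lam * r ^ 2) /
            (1 + s * Pu * (v ^ 2 + r ^ 2 + 2 * v * r * Real.cos φ) ^ (-α / 2)))) * v) ∂ν.fst := by
  have hprob : IsProbabilityMeasure (linkDistanceMeasure lam) := hνR ▸ inferInstance
  have hi := integrable_radialDefect hα hPu hs hν
  have hfst : ∀ᵐ p ∂ν.fst, 0 ≤ p := by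
    rw [Measure.fst, ae_map_iff measurable_fst.aemeasurable measurableSet_Ici]
    exact hν.mono fun q hq => hq.1
  have hi1 : Integrable (fun q => ∫ v in Set.Ioi (0 : ℝ), radialDefect α Pu s q v)
      (ν.fst.prod ν.snd) := by
    rw [← hind]
    exact hi.integral_prod_left
  -- Reassociating the product makes the defect integrable in `(r, v)` for almost every power, which
  -- licenses moving the average over `r` inside the integral over `v`.
  have hi2 : Integrable (fun x : ℝ × ℝ × ℝ => radialDefect α Pu s (x.1, x.2.1) x.2.2)
      (ν.fst.prod (ν.snd.prod (volume.restrict (Set.Ioi 0)))) := by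
    rw [hind] at hi
    exact ((measurePreserving_prodAssoc ν.fst ν.snd (volume.restrict (Set.Ioi 0))).symm
      |>.integrable_comp_emb (MeasurableEquiv.measurableEmbedding _)).2 hi
  conv_lhs => rw [hind]
  rw [integral_prod _ hi1]
  refine integral_congr_ae ?_
  filter_upwards [hi2.prod_right_ae, hfst] with p hp hp0
  rw [integral_integral_swap hp]
  refine setIntegral_congr_fun measurableSet_Ioi fun v hv => ?_
  rw [hνR, integral_radialDefect_linkDistance hlam hPu hs hp0 (le_of_lt hv)]

end FDNetwork

/-! ### Application to the network -/

namespace FDNetwork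

open Filter Topology

lemma measurable_displacement :
    Measurable fun m : (ℝ × ℝ) × ℝ × ℝ × ℝ => polarVec m.1.2 m.2.1 :=
  measurable_polarVec.comp (g := fun p : ℝ × ℝ => polarVec p.1 p.2)
    (f := fun m : (ℝ × ℝ) × ℝ × ℝ × ℝ => (m.1.2, m.2.1)) (by fun_prop)

namespace Network

variable {Ω : Type*}

/-- The aggregate interference, as an element of `[0, ∞]`. -/
noncomputable def eInterference (N : Network Ω) (α Pu : ℝ) (i : ℕ) (ω : Ω) : ℝ≥0∞ :=
  ∑' j, if j = i then 0 else ENNReal.ofReal (N.pairInterference α Pu j (N.ue i ω) ω)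

lemma pairInterference_eq (N : Network Ω) (α Pu : ℝ) (j : ℕ) (y : Plane) (ω : Ω) :
    N.pairInterference α Pu j y ω = pairPower α Pu (N.X j ω - y) (N.mark j ω) := by
  have : N.ue j ω - y = N.X j ω - y + polarVec (N.R j ω) (N.φ j ω) := by
    rw [ue, polarVec]; abel
  rw [pairInterference, pairPower, this]
  rfl

lemma ofReal_interference {N : Network Ω} {α Pu : ℝ} {i : ℕ} {ω : Ω}
    (h0 : ∀ j y, 0 ≤ N.pairInterference α Pu j y ω)
    (hs : Summable fun j => if j = i then 0 else N.pairInterference α Pu j (N.ue i ω) ω) :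
    ENNReal.ofReal (N.interference α Pu i ω) = N.eInterference α Pu i ω := by
  rw [interference, ENNReal.ofReal_tsum_of_nonneg (fun j => by split_ifs; exacts [le_rfl, h0 _ _]) hs,
    eInterference]
  refine tsum_congr fun j => ?_
  split_ifs <;> simp

lemma summable_of_eInterference_ne_top {N : Network Ω} {α Pu : ℝ} {i : ℕ} {ω : Ω}
    (h0 : ∀ j y, 0 ≤ N.pairInterference α Pu j y ω) (h : N.eInterference α Pu i ω ≠ ∞) :
    Summable fun j => if j = i then 0 else N.pairInterference α Pu j (N.ue i ω) ω := by
  refine (ENNReal.summable_toReal h).congr fun j => ?_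
  split_ifs
  · simp
  · exact ENNReal.toReal_ofReal (h0 _ _)

variable [MeasurableSpace Ω] {μ : Measure Ω} {N : Network Ω} {lam lamB α Pu Pmax : ℝ}
  {ν : Measure (ℝ × ℝ)}

namespace IsMarkedPPP

/-- The mark law has mass one and so do its direction and fading factors, which forces the mass of
`ν`. -/
lemma isProbabilityMeasure [IsProbabilityMeasure μ] (hN : N.IsMarkedPPP μ lamB ν) :
    IsProbabilityMeasure ν := by
  have h := (hN.hasLaw_mark 0).isProbabilityMeasure_iff.1 inferInstance
  have h1 := h.measure_univ
  rw [← Set.univ_prod_univ, Measure.prod_prod,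
    measure_univ (μ := angleMeasure.prod ((expMeasure 1).prod (expMeasure 1))), mul_one] at h1
  exact ⟨h1⟩

lemma measurable_interferenceTerm (hN : N.IsMarkedPPP μ lamB ν) (α Pu : ℝ) (i j : ℕ) :
    Measurable fun ω => N.pairInterference α Pu j (N.ue i ω) ω := by
  simp_rw [pairInterference_eq]
  have h1 := hN.ppp.measurable i
  have h2 := hN.ppp.measurable j
  have h3 : Measurable fun ω => polarVec (N.mark i ω).1.2 (N.mark i ω).2.1 :=
    measurable_displacement.comp (hN.measurable_mark i)
  exact (measurable_pairPower α Pu).comp ((h2.sub (h1.add h3)).prodMk (hN.measurable_mark j))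

lemma measurable_eInterference (hN : N.IsMarkedPPP μ lamB ν) (α Pu : ℝ) (i : ℕ) :
    Measurable (N.eInterference α Pu i) := by
  refine Measurable.tsum fun j => ?_
  split_ifs
  · fun_prop
  · exact (hN.measurable_interferenceTerm α Pu i j).ennreal_ofReal

lemma ae_pairInterference_nonneg [IsProbabilityMeasure μ] (hN : N.IsMarkedPPP μ lamB ν)
    (hPu : 0 ≤ Pu) (hν : ∀ᵐ q ∂ν, 0 ≤ q.1) :
    ∀ᵐ ω ∂μ, ∀ j y, 0 ≤ N.pairInterference α Pu j y ω := by
  have := hN.isProbabilityMeasure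
  rw [ae_all_iff]
  intro j
  have hm : Measurable fun m : (ℝ × ℝ) × ℝ × ℝ × ℝ => 0 ≤ m.1.1 ∧ 0 ≤ m.2.2.1 ∧ 0 ≤ m.2.2.2 := by
    measurability
  have h : ∀ᵐ m ∂(markLaw ν), 0 ≤ m.1.1 ∧ 0 ≤ m.2.2.1 ∧ 0 ≤ m.2.2.2 := by
    have hexp : ∀ᵐ h ∂((expMeasure 1).prod (expMeasure 1)), 0 ≤ h.1 ∧ 0 ≤ h.2 :=
      (Measure.quasiMeasurePreserving_fst.ae ae_nonneg_expMeasure).and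
        (Measure.quasiMeasurePreserving_snd.ae ae_nonneg_expMeasure)
    filter_upwards [Measure.quasiMeasurePreserving_fst.ae hν,
      Measure.quasiMeasurePreserving_snd.ae (Measure.quasiMeasurePreserving_snd.ae hexp)]
      with m h1 h2 using ⟨h1, h2⟩
  filter_upwards [((hN.hasLaw_mark j).ae_iff hm).2 h] with ω hω y
  obtain ⟨h1, h2, h3⟩ := hω
  rw [pairInterference_eq, pairPower]
  positivity

lemma lintegral_tsum_expNeg [IsProbabilityMeasure μ] (hN : N.IsMarkedPPP μ lamB ν)
    (hlamB : 0 ≤ lamB) (hνR : ν.snd = linkDistanceMeasure lam) {W : Set Plane}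
    (hW : MeasurableSet W) (s : ℝ) :
    ∫⁻ ω, ∑' i, W.indicator 1 (N.X i ω) *
        expNeg (ENNReal.ofReal s * N.eInterference α Pu i ω) ∂μ
      = ENNReal.ofReal lamB * volume W * expNeg (ENNReal.ofReal lamB * exponent α Pu ν s) := by
  have := hN.isProbabilityMeasure
  -- The displacement involves only link distance and direction, so the fading coordinates can be
  -- projected away.
  have hac : (markLaw ν).map (fun m => polarVec m.1.2 m.2.1) ≪ volume := by
    have h := map_polarVec_absolutelyContinuous lam hνR
    have h1 : ν.prod angleMeasure = (markLaw ν).map (Prod.map id Prod.fst) := by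
      rw [markLaw, ← Measure.map_prod_map _ _ measurable_id measurable_fst, Measure.map_id]
      congr 1
      exact Measure.fst_prod.symm
    have hq : Measurable fun q : (ℝ × ℝ) × ℝ => polarVec q.1.2 q.2 :=
      measurable_polarVec.comp (g := fun p : ℝ × ℝ => polarVec p.1 p.2)
        (f := fun q : (ℝ × ℝ) × ℝ => (q.1.2, q.2)) (by fun_prop)
    rw [h1, Measure.map_map hq (by fun_prop)] at h
    exact h
  have hg : Measurable (Function.uncurry fun z m =>
      ENNReal.ofReal s * ENNReal.ofReal (pairPower α Pu z m)) :=
    (measurable_pairPower α Pu).ennreal_ofReal.const_mul _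
  have h := hN.ppp.palm_laplace_marked hlamB (ρ := markLaw ν) hN.measurable_mark
    (fun i => (hN.hasLaw_mark i).map_eq) hN.iIndep_mark hN.indep_mark measurable_displacement hac hg
    (fun z m => ENNReal.mul_ne_top ENNReal.ofReal_ne_top ENNReal.ofReal_ne_top) hW
  rw [exponent, ← h]
  refine lintegral_congr fun ω => tsum_congr fun i => ?_
  rw [eInterference, ← ENNReal.tsum_mul_left]
  congr 2
  refine tsum_congr fun j => ?_
  split_ifs
  · simp
  · rw [pairInterference_eq]
    rfl

/-- As `s → 0` the Palm formula loses no mass because the exponent tends to `0`, whereas a UE with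
infinite interference contributes `0` for every `s > 0`. -/
lemma ae_eInterference_ne_top_of_mem [IsProbabilityMeasure μ] (hN : N.IsMarkedPPP μ lamB ν)
    (hlamB : 0 ≤ lamB) (hα : 2 < α) (hPu : 0 ≤ Pu) (hν : ∀ᵐ q ∂ν, q.1 ∈ Set.Icc 0 Pmax)
    (hνR : ν.snd = linkDistanceMeasure lam) {W : Set Plane} (hW : MeasurableSet W)
    (hW' : volume W ≠ ∞) :
    ∀ᵐ ω ∂μ, ∀ i, N.X i ω ∈ W → N.eInterference α Pu i ω ≠ ∞ := by
  have := hN.isProbabilityMeasure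
  have hIm := fun i => hN.measurable_eInterference α Pu i
  have hWm : ∀ i, Measurable fun ω => W.indicator (1 : Plane → ℝ≥0∞) (N.X i ω) := fun i =>
    (measurable_one.indicator hW).comp (hN.ppp.measurable i)
  have hexpm : ∀ s i, Measurable fun ω => W.indicator (1 : Plane → ℝ≥0∞) (N.X i ω) *
      expNeg (ENNReal.ofReal s * N.eInterference α Pu i ω) := fun s i =>
    (hWm i).mul (measurable_expNeg.comp ((hIm i).const_mul _))
  -- `U` counts the BSs in `W` whose UE sees infinite interference.
  set U : Ω → ℝ≥0∞ := fun ω => ∑' i, W.indicator 1 (N.X i ω) *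
    {ω | N.eInterference α Pu i ω = ∞}.indicator 1 ω
  have hS : ∀ i, MeasurableSet {ω | N.eInterference α Pu i ω = ∞} := fun i =>
    hIm i (measurableSet_singleton _)
  have hUm : Measurable U := Measurable.tsum fun i => (hWm i).mul (measurable_one.indicator (hS i))
  have hmean : ENNReal.ofReal lamB * volume W ≠ ∞ := ENNReal.mul_ne_top (by simp) hW'
  -- Pointwise `1_{I = ∞} + e^{-sI} ≤ 1` for `s = 1 / (n + 1)`; summing over the BSs in `W` compares
  -- with the mean count.
  have hle : ∀ n : ℕ, ∫⁻ ω, U ω ∂μ + ENNReal.ofReal lamB * volume W *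
      expNeg (ENNReal.ofReal lamB * exponent α Pu ν (1 / ((n : ℝ) + 1)))
      ≤ ENNReal.ofReal lamB * volume W := by
    intro n
    rw [← hN.lintegral_tsum_expNeg hlamB hνR hW, ← hN.ppp.lintegral_count hlamB hW hW',
      ← lintegral_add_left hUm]
    refine lintegral_mono fun ω => ?_
    simp only [U]
    rw [← ENNReal.tsum_add]
    refine ENNReal.tsum_le_tsum fun i => ?_
    rw [← mul_add]
    refine (mul_le_of_le_one_right' ?_).trans_eq rfl
    by_cases h : N.eInterference α Pu i ω = ∞
    · have hpos : ENNReal.ofReal (1 / ((n : ℝ) + 1)) ≠ 0 := by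
        rw [Ne, ENNReal.ofReal_eq_zero, not_le]
        positivity
      simp only [Set.indicator, Set.mem_ofPred_eq, h, if_true, ENNReal.mul_top hpos, expNeg_top]
      simp
    · simpa [h] using expNeg_le_one _
  have hlim : Tendsto (fun n : ℕ => ∫⁻ ω, U ω ∂μ + ENNReal.ofReal lamB * volume W *
      expNeg (ENNReal.ofReal lamB * exponent α Pu ν (1 / ((n : ℝ) + 1)))) atTop
      (𝓝 (∫⁻ ω, U ω ∂μ + ENNReal.ofReal lamB * volume W * expNeg (ENNReal.ofReal lamB * 0))) := by
    refine tendsto_const_nhds.add (ENNReal.Tendsto.const_mul ?_ (Or.inr hmean))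
    exact (continuous_expNeg.tendsto _).comp
      (ENNReal.Tendsto.const_mul (tendsto_exponent hα hPu hν) (by simp))
  have hfinal := le_of_tendsto hlim (Eventually.of_forall hle)
  rw [mul_zero, expNeg_zero, mul_one] at hfinal
  have hU0 : ∫⁻ ω, U ω ∂μ = 0 := by
    by_contra hne
    exact (ENNReal.lt_add_right hmean hne).not_ge (by rwa [add_comm])
  rw [lintegral_eq_zero_iff hUm] at hU0
  filter_upwards [hU0] with ω hω i hi htop
  have := ENNReal.tsum_eq_zero.1 hω i
  simp [hi, htop] at this

lemma ae_eInterference_ne_top [IsProbabilityMeasure μ] (hN : N.IsMarkedPPP μ lamB ν)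
    (hlamB : 0 ≤ lamB) (hα : 2 < α) (hPu : 0 ≤ Pu) (hν : ∀ᵐ q ∂ν, q.1 ∈ Set.Icc 0 Pmax)
    (hνR : ν.snd = linkDistanceMeasure lam) :
    ∀ᵐ ω ∂μ, ∀ i, N.eInterference α Pu i ω ≠ ∞ := by
  have h := fun n => hN.ae_eInterference_ne_top_of_mem hlamB hα hPu hν hνR
    (measurableSet_spanningSets (volume : Measure Plane) n) (measure_spanningSets_lt_top _ n).ne
  filter_upwards [ae_all_iff.2 h] with ω hω i
  have : N.X i ω ∈ ⋃ n, spanningSets (volume : Measure Plane) n := by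
    simp [iUnion_spanningSets]
  obtain ⟨n, hn⟩ := Set.mem_iUnion.1 this
  exact hω n i hn

lemma ae_summable [IsProbabilityMeasure μ] (hN : N.IsMarkedPPP μ lamB ν)
    (hlamB : 0 ≤ lamB) (hα : 2 < α) (hPu : 0 ≤ Pu) (hν : ∀ᵐ q ∂ν, q.1 ∈ Set.Icc 0 Pmax)
    (hνR : ν.snd = linkDistanceMeasure lam) :
    ∀ᵐ ω ∂μ, ∀ i, Summable (fun j =>
      if j = i then 0 else N.pairInterference α Pu j (N.ue i ω) ω) := by
  filter_upwards [hN.ae_eInterference_ne_top hlamB hα hPu hν hνR,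
    hN.ae_pairInterference_nonneg hPu (hν.mono fun q hq => hq.1)] with ω h h0 i
  exact summable_of_eInterference_ne_top h0 (h i)

lemma typicalLaplace_eq [IsProbabilityMeasure μ] (hN : N.IsMarkedPPP μ lamB ν)
    (hlamB : 0 < lamB) (hα : 2 < α) (hPu : 0 ≤ Pu) (hν : ∀ᵐ q ∂ν, q.1 ∈ Set.Icc 0 Pmax)
    (hνR : ν.snd = linkDistanceMeasure lam) {W : Set Plane} (hW : MeasurableSet W)
    (hW0 : volume W ≠ 0) (hW' : volume W ≠ ∞) {s : ℝ} (hs : 0 ≤ s) :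
    N.typicalLaplace μ lamB α Pu W s = Real.exp (-2 * Real.pi * lamB *
      ∫ q, (∫ v in Set.Ioi (0 : ℝ), radialDefect α Pu s q v) ∂ν) := by
  have := hN.isProbabilityMeasure
  set J := ∫ q, (∫ v in Set.Ioi (0 : ℝ), radialDefect α Pu s q v) ∂ν
  obtain ⟨hJ0, hJ⟩ := exponent_eq_integral (ν := ν) hα hPu hs hν
  set T : Ω → ℝ≥0∞ := fun ω => ∑' i, W.indicator 1 (N.X i ω) *
    expNeg (ENNReal.ofReal s * N.eInterference α Pu i ω)
  have hTm : Measurable T := Measurable.tsum fun i =>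
    ((measurable_one.indicator hW).comp (hN.ppp.measurable i)).mul
      (measurable_expNeg.comp ((hN.measurable_eInterference α Pu i).const_mul _))
  have hT := hN.lintegral_tsum_expNeg (α := α) (Pu := Pu) hlamB.le hνR hW s
  have hTfin : ∫⁻ ω, T ω ∂μ ≠ ∞ := by
    rw [hT]
    exact ENNReal.mul_ne_top (ENNReal.mul_ne_top (by simp) hW') (expNeg_ne_top _)
  -- A real series that is not summable has the default value `0`, so `interference` agrees with
  -- `eInterference` only where summability is known, that is, almost surely.
  have hae : ∀ᵐ ω ∂μ, ∑' i, W.indicator (fun _ => Real.exp (-s * N.interference α Pu i ω)) (N.X i ω)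
      = (T ω).toReal := by
    filter_upwards [hN.ae_summable hlamB.le hα hPu hν hνR,
      hN.ae_pairInterference_nonneg hPu (hν.mono fun q hq => hq.1)] with ω hsum h0
    have hterm : ∀ i, W.indicator 1 (N.X i ω) *
        expNeg (ENNReal.ofReal s * N.eInterference α Pu i ω) = ENNReal.ofReal
        (W.indicator (fun _ => Real.exp (-s * N.interference α Pu i ω)) (N.X i ω)) := by
      intro i
      have hI0 : 0 ≤ N.interference α Pu i ω :=
        tsum_nonneg fun j => by split_ifs; exacts [le_rfl, h0 _ _]
      rw [← ofReal_interference h0 (hsum i), ← ENNReal.ofReal_mul hs,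
        expNeg_ofReal (mul_nonneg hs hI0), neg_mul]
      by_cases hi : N.X i ω ∈ W <;> simp [hi]
    simp only [T]
    rw [tsum_congr hterm, ENNReal.tsum_toReal_eq (fun _ => ENNReal.ofReal_ne_top)]
    refine tsum_congr fun i => ?_
    rw [ENNReal.toReal_ofReal]
    exact Set.indicator_nonneg (fun _ _ => (Real.exp_pos _).le) _
  rw [typicalLaplace, integral_congr_ae hae, integral_toReal hTm.aemeasurable
    (ae_lt_top hTm hTfin), hT, hJ, ← ENNReal.ofReal_mul hlamB.le, expNeg_ofReal (by positivity)]
  rw [ENNReal.toReal_mul, ENNReal.toReal_mul, ENNReal.toReal_ofReal hlamB.le,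
    ENNReal.toReal_ofReal (Real.exp_pos _).le, ← measureReal_def, mul_div_cancel_left₀]
  · congr 1
    ring
  · exact mul_ne_zero hlamB.ne' (ENNReal.toReal_ne_zero.2 ⟨hW0, hW'⟩)

end IsMarkedPPP

end Network

end FDNetwork

theorem theorem1 {Ω : Type*} [MeasurableSpace Ω] (μ : Measure Ω) [IsProbabilityMeasure μ]
    (lam lamB α Pu Pmax : ℝ) (hlam : 0 < lam) (hlamB : 0 < lamB) (hα : 2 < α) (hPu : 0 ≤ Pu)
    -- `ν` is the joint law of the transmit power of a BS and its link distance
    (ν : Measure (ℝ × ℝ)) (hνP : ∀ᵐ q ∂ν, q.1 ∈ Set.Icc 0 Pmax)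
    (hνR : ν.snd = FDNetwork.linkDistanceMeasure lam)
    (N : FDNetwork.Network Ω) (hN : N.IsMarkedPPP μ lamB ν) :
    -- the aggregate interference is almost surely finite
    (∀ᵐ ω ∂μ, ∀ i, Summable (fun j =>
      if j = i then 0 else N.pairInterference α Pu j (N.ue i ω) ω)) ∧
    ∀ W : Set FDNetwork.Plane, MeasurableSet W → volume W ≠ 0 → volume W ≠ ∞ →
    ∀ s : ℝ, 0 ≤ s →
      -- powers independent of the link distances
      (ν = ν.fst.prod ν.snd →
        N.typicalLaplace μ lamB α Pu W s =
          Real.exp (-2 * Real.pi * lamB * ∫ p, (∫ v in Set.Ioi (0 : ℝ),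
            (1 - ∫ φ in (0 : ℝ)..(2 * Real.pi), ∫ r in Set.Ioi (0 : ℝ),
              1 / (1 + s * p * v ^ (-α)) *
                (lam * r * Real.exp (-Real.pi * lam * r ^ 2) /
                  (1 + s * Pu * (v ^ 2 + r ^ 2 + 2 * v * r * Real.cos φ) ^ (-α / 2)))) * v)
            ∂ν.fst)) ∧
      -- powers that may depend on the link distances
      N.typicalLaplace μ lamB α Pu W s =
        Real.exp (-2 * Real.pi * lamB * ∫ q, (∫ v in Set.Ioi (0 : ℝ),
          (1 - 1 / (2 * Real.pi) * ∫ φ in (0 : ℝ)..(2 * Real.pi),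
            1 / (1 + s * q.1 * v ^ (-α)) *
              (1 / (1 + s * Pu * (v ^ 2 + q.2 ^ 2 + 2 * v * q.2 * Real.cos φ) ^ (-α / 2)))) * v)
          ∂ν) := by
  refine ⟨hN.ae_summable hlamB.le hα hPu hνP hνR, fun W hW hW0 hW' s hs => ⟨fun hind => ?_, ?_⟩⟩
  · have := hN.isProbabilityMeasure
    rw [hN.typicalLaplace_eq hlamB hα hPu hνP hνR hW hW0 hW' hs,
      FDNetwork.integral_radialDefect_of_indep hlam.le hα hPu hs hνP hνR hind]
  · exact hN.typicalLaplace_eq hlamB hα hPu hνP hνR hW hW0 hW' hs
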